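/- **Setting.** Write $\tau_0=t$. A *differential function* is a smooth function of finitely many of the variables $x,\tau_0,\tau_1,\dots,u,u_x,u_{xx},\dots$, defined on an open set of jets. A *hierarchy of pseudo-spherical type* is a sequence of evolution equations $u_{\tau_i}=F_i$, $i\ge 0$, together with differential functions $f_{\alpha 1},f_{\alpha 2},h_{\alpha i}$ ($\alpha=1,2,3$, $i\ge 1$) on the same open set of jets as the differential functions $F_i$, such that for every $n\ge 0$ the forms $$\Theta^{[n]}_\alpha=f_{\alpha1}\,dx+f_{\alpha2}\,dt+\sum_{i=1}^n h_{\alpha i}\,d\tau_i$$ satisfy $d_H\Theta^{[n]}_1=\Theta^{[n]}_3\wedge\Theta^{[n]}_2$, $d_H\Theta^{[n]}_2=\Theta^{[n]}_1\wedge\Theta^{[n]}_3$, $d_H\Theta^{[n]}_3=\Theta^{[n]}_1\wedge\Theta^{[n]}_2$. Here $d_Hg=D_xg\,dx+\sum_{i=0}^nD_{\tau_i}g\,d\tau_i$, with $D_x=\partial_x+\sum_{j\ge0}u_{x^{j+1}}\partial_{u_{x^j}}$ and $D_{\tau_i}=\partial_{\tau_i}+\sum_{j\ge0}(D_x^jF_i)\,\partial_{u_{x^j}}$.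 A *solution* is a sequence of smooth functions $u^{[n]}(x,t,\tau_1,\dots,\tau_n)$ on nonempty open subsets of $\mathbb R^{n+2}$ that satisfy $u_{\tau_i}=F_i$ for $0\le i\le n$, such that $u^{[n+1]}$ restricts to $u^{[n]}$. In restrictions $\mathbb R^{n+2}$ is identified with $\{\tau_{n+1}=0\}\subset\mathbb R^{n+3}$, and pull-backs by $u^{[n]}$ are evaluated at $\tau_i=0$ for $i>n$. The function $u^{[0]}$ is *III-generic* if the pull-back of $f_{11}f_{22}-f_{12}f_{21}$ by $u^{[0]}$ vanishes nowhere on the domain of $u^{[0]}$. **Statement.** Let $u_{\tau_i}=F_i$ and $\hat u_{\hat\tau_i}=\hat F_i$, $i\ge0$, be two hierarchies of pseudo-spherical type with associated functions $f_{\alpha\beta},h_{\alpha i}$ and $\hat f_{\alpha\beta},\hat h_{\alpha i}$ and associated forms $\Theta^{[n]}_\alpha$ and $\hat\Theta^{[n]}_\alpha$. Let $\{u^{[n]}\}$ and $\{\hat u^{[n]}\}$ be solutions of them such that $u^{[0]}$ and $\hat u^{[0]}$ are III-generic. Then there exist sequences of maps $\{\Upsilon^{[n]}\}_{n\ge0}$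 and $\{\mu^{[n]}\}_{n\ge0}$ such that, with all coefficients and forms pulled back by $u^{[n]}$ and $\hat u^{[n]}$ respectively, the following hold for every $n\ge0$. (a) $\Upsilon^{[n]}=(\psi^{[n]},\varphi^{[n]},\phi^{[n]}_1,\dots,\phi^{[n]}_n)$ is a diffeomorphism from a nonempty open subset $V^{[n]}$ of the domain of $u^{[n]}$ onto an open subset $\hat V^{[n]}$ of the domain of $\hat u^{[n]}$. (b) $\mu^{[n]}:V^{[n]}\to\mathbb R$ is smooth. (c) On $V^{[n]}$, $\Delta^{[n]}\neq0$ and $$\hat f_{11}\circ\Upsilon^{[n]}=\frac{\Delta^{[n]}_1}{\Delta^{[n]}},\qquad \hat f_{12}\circ\Upsilon^{[n]}=\frac{\Delta^{[n]}_2}{\Delta^{[n]}},\qquad \hat h_{1j}\circ\Upsilon^{[n]}=\frac{\Delta^{[n]}_{j+2}}{\Delta^{[n]}}\quad(1\le j\le n),$$ where $$\Delta^{[n]}=\begin{vmatrix}\psi^{[n]}_x&\varphi^{[n]}_x&0&\cdots&0\\ \psi^{[n]}_t&\varphi^{[n]}_t&0&\cdots&0\\ \psi^{[n]}_{\tau_1}&\varphi^{[n]}_{\tau_1}&1&\cdots&0\\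 \vdots&\vdots&\vdots&\ddots&\vdots\\ \psi^{[n]}_{\tau_n}&\varphi^{[n]}_{\tau_n}&0&\cdots&1\end{vmatrix}=\psi^{[n]}_x\varphi^{[n]}_t-\varphi^{[n]}_x\psi^{[n]}_t ,$$ and $\Delta^{[n]}_i$ is obtained from $\Delta^{[n]}$ by replacing its $i$-th column by the column with entries $f_{11}\cos\mu^{[n]}+f_{21}\sin\mu^{[n]}$, $f_{12}\cos\mu^{[n]}+f_{22}\sin\mu^{[n]}$, $h_{11}\cos\mu^{[n]}+h_{21}\sin\mu^{[n]}$, …, $h_{1n}\cos\mu^{[n]}+h_{2n}\sin\mu^{[n]}$. (d) $\phi^{[n]}_j=\tau_j$ for $1\le j\le n$, and $$\Upsilon^{[n]*}\hat\Theta^{[n]}_1=\Theta^{[n]}_1\cos\mu^{[n]}+\Theta^{[n]}_2\sin\mu^{[n]},\quad \Upsilon^{[n]*}\hat\Theta^{[n]}_2=-\Theta^{[n]}_1\sin\mu^{[n]}+\Theta^{[n]}_2\cos\mu^{[n]},\quad \Upsilon^{[n]*}\hat\Theta^{[n]}_3=\Theta^{[n]}_3+d\mu^{[n]}.$$ (e)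 $V^{[n]}\subset V^{[n+1]}$, $\Upsilon^{[n+1]}|_{V^{[n]}}=\Upsilon^{[n]}$ and $\mu^{[n+1]}|_{V^{[n]}}=\mu^{[n]}$. -/

import Mathlib

open scoped ContDiff

namespace PSS

/-- The space `ℝⁿ⁺²` of independent variables `(x, t, τ₁, …, τₙ)`: coordinate `0` is `x`, and
coordinate `i + 1` is `τᵢ`, with `τ₀ = t`. -/
abbrev Space (n : ℕ) : Type := Fin (n + 2) → ℝ

/-- The infinite jet space. For `p = (z, w)`, `z 0` is `x`, `z (i + 1)` is `τᵢ` (with `τ₀ = t`), and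
`w j` is the jet coordinate `u_{xʲ}` (with `u_{x⁰} = u`). -/
abbrev Jet : Type := (ℕ → ℝ) × (ℕ → ℝ)

/-- The first `m` independent variables and the first `m` jet coordinates. -/
def truncate (m : ℕ) (p : Jet) : (Fin m → ℝ) × (Fin m → ℝ) :=
  (fun k => p.1 k, fun j => p.2 j)

/-- `g` is a differential function on the set `U` of jets: on `U` it depends only on finitely many
of the coordinates `x, t, τ₁, …, u, u_x, u_xx, …`, and it depends smoothly on them. -/
def IsDifferentialFunction (U : Set Jet) (g : Jet → ℝ) : Prop :=
  ∃ (m : ℕ) (G : (Fin m → ℝ) × (Fin m → ℝ) → ℝ),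
    ∀ p ∈ U, g p = G (truncate m p) ∧ ContDiffAt ℝ ∞ G (truncate m p)

/-- The partial derivative of `g` in the independent variable number `k`. -/
noncomputable def partialVar (k : ℕ) (g : Jet → ℝ) (p : Jet) : ℝ :=
  deriv (fun s => g (Function.update p.1 k s, p.2)) (p.1 k)

/-- The partial derivative of `g` in the jet coordinate `u_{xʲ}`. -/
noncomputable def partialJet (j : ℕ) (g : Jet → ℝ) (p : Jet) : ℝ :=
  deriv (fun s => g (p.1, Function.update p.2 j s)) (p.2 j)

/-- The total derivative `D_x = ∂/∂x + ∑_j u_{xʲ⁺¹} ∂/∂u_{xʲ}`. -/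
noncomputable def totalX (g : Jet → ℝ) (p : Jet) : ℝ :=
  partialVar 0 g p + ∑ᶠ j : ℕ, p.2 (j + 1) * partialJet j g p

/-- The total derivative `D_{τᵢ} = ∂/∂τᵢ + ∑_j (D_xʲ Fᵢ) ∂/∂u_{xʲ}` of the system `u_{τᵢ} = Fᵢ`. -/
noncomputable def totalTau (F : ℕ → Jet → ℝ) (i : ℕ) (g : Jet → ℝ) (p : Jet) : ℝ :=
  partialVar (i + 1) g p + ∑ᶠ j : ℕ, (totalX^[j] (F i)) p * partialJet j g p

/-- The total derivatives numbered as the independent variables are: `D_x, D_t, D_{τ₁}, …`. -/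
noncomputable def totalD (F : ℕ → Jet → ℝ) : ℕ → (Jet → ℝ) → Jet → ℝ
  | 0 => totalX
  | i + 1 => totalTau F i

/-- The coefficient at `dz_a ∧ dz_b` of the horizontal differential `d_H ξ` of a
one-form `ξ = ∑ ξ_k dz_k`, where `z₀ = x` and `zᵢ₊₁ = τᵢ`. -/
noncomputable def dH (F : ℕ → Jet → ℝ) (ξ : ℕ → Jet → ℝ) (a b : ℕ) (p : Jet) : ℝ :=
  totalD F a (ξ b) p - totalD F b (ξ a) p

/-- The coefficient at `dz_a ∧ dz_b` of `ξ ∧ η`, for `ξ = ∑ ξ_k dz_k` and `η = ∑ η_k dz_k`. -/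
def wedge (ξ η : ℕ → Jet → ℝ) (a b : ℕ) (p : Jet) : ℝ :=
  ξ a p * η b p - ξ b p * η a p

/-- The sequence of coefficients `f_{α1}, f_{α2}, h_{α1}, h_{α2}, …` of the forms
`Θ_α = f_{α1} dx + f_{α2} dt + ∑ h_{αi} dτᵢ`. All indices start from `0` here: `f 0 1` stands for
`f_{12}`, and `h 0 j` stands for `h_{1,j+1}`. -/
def coeffs (f : Fin 3 → Fin 2 → Jet → ℝ) (h : Fin 3 → ℕ → Jet → ℝ) (α : Fin 3) :
    ℕ → Jet → ℝ
  | 0 => f α 0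
  | 1 => f α 1
  | j + 2 => h α j

/-- A hierarchy `u_{τᵢ} = Fᵢ`, `i ≥ 0`, of pseudo-spherical type, with its associated functions
`f_{αβ}` and `h_{αi}` (numbered as in `coeffs`); all of them are differential functions on an open
set `dom` of jets. -/
structure Hierarchy where
  dom : Set Jet
  isOpen_dom : IsOpen dom
  F : ℕ → Jet → ℝ
  f : Fin 3 → Fin 2 → Jet → ℝ
  h : Fin 3 → ℕ → Jet → ℝ
  F_smooth : ∀ i, IsDifferentialFunction dom (F i)
  f_smooth : ∀ α β, IsDifferentialFunction dom (f α β)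
  h_smooth : ∀ α j, IsDifferentialFunction dom (h α j)
  /-- `d_H Θ₁ = Θ₃ ∧ Θ₂`, for each of the forms `Θ^{[n]}`. -/
  structure_one : ∀ n : ℕ, ∀ a b : Fin (n + 2), ∀ p ∈ dom,
    dH F (coeffs f h 0) a b p = wedge (coeffs f h 2) (coeffs f h 1) a b p
  /-- `d_H Θ₂ = Θ₁ ∧ Θ₃`. -/
  structure_two : ∀ n : ℕ, ∀ a b : Fin (n + 2), ∀ p ∈ dom,
    dH F (coeffs f h 1) a b p = wedge (coeffs f h 0) (coeffs f h 2) a b p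
  /-- `d_H Θ₃ = Θ₁ ∧ Θ₂`. -/
  structure_three : ∀ n : ℕ, ∀ a b : Fin (n + 2), ∀ p ∈ dom,
    dH F (coeffs f h 2) a b p = wedge (coeffs f h 0) (coeffs f h 1) a b p

/-- The point of the space of all independent variables `(x, t, τ₁, τ₂, …)` that has the coordinates
of `q` and `τᵢ = 0` for `i > n`. -/
def extend {n : ℕ} (q : Space n) (k : ℕ) : ℝ :=
  if hk : k < n + 2 then q ⟨k, hk⟩ else 0

/-- The inclusion `ℝⁿ⁺² → ℝⁿ⁺³` as the hyperplane `τₙ₊₁ = 0`. -/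
def incl {n : ℕ} (q : Space n) : Space (n + 1) := fun k => extend q k

/-- The partial derivative of `g` in the independent variable number `k`. -/
noncomputable def pd {n : ℕ} (k : Fin (n + 2)) (g : Space n → ℝ) (q : Space n) : ℝ :=
  fderiv ℝ g q (Pi.single k 1)

/-- The jet at `q` of a function `u (x, t, τ₁, …, τₙ)`. -/
noncomputable def jet {n : ℕ} (u : Space n → ℝ) (q : Space n) : Jet :=
  (extend q, fun j => ((pd 0)^[j] u) q)

/-- A local solution `{u^{[n]}}` of a hierarchy: smooth functions `u^{[n]}` on open sets
`V^{[n]} ⊆ ℝⁿ⁺²` that solve the equations `u_{τᵢ} = Fᵢ`, `0 ≤ i ≤ n`, such that `u^{[n+1]}`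
restricts to `u^{[n]}` on `V^{[n]}`, seen in `τₙ₊₁ = 0`. -/
structure Hierarchy.Solution (H : Hierarchy) where
  V : ∀ n : ℕ, Set (Space n)
  u : ∀ n : ℕ, Space n → ℝ
  isOpen_V : ∀ n, IsOpen (V n)
  nonempty_V : (V 0).Nonempty
  smooth : ∀ n, ContDiffOn ℝ ∞ (u n) (V n)
  jet_mem : ∀ n, ∀ q ∈ V n, jet (u n) q ∈ H.dom
  equation : ∀ n, ∀ i : Fin (n + 1), ∀ q ∈ V n, pd i.succ (u n) q = H.F i (jet (u n) q)
  incl_mem : ∀ n, ∀ q ∈ V n, incl q ∈ V (n + 1)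
  restrict : ∀ n, ∀ q ∈ V n, u (n + 1) (incl q) = u n q

namespace Hierarchy.Solution

variable {H : Hierarchy}

/-- The pull-back of `f_{αβ}` by `u^{[n]}`. -/
noncomputable def f (S : H.Solution) (n : ℕ) (α : Fin 3) (β : Fin 2) (q : Space n) : ℝ :=
  H.f α β (jet (S.u n) q)

/-- The pull-back of `h_{α,j+1}` by `u^{[n]}`. -/
noncomputable def h (S : H.Solution) (n : ℕ) (α : Fin 3) (j : ℕ) (q : Space n) : ℝ :=
  H.h α j (jet (S.u n) q)

/-- The coefficient of the pull-back of `Θ_α^{[n]}` by `u^{[n]}` at the differential of the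
independent variable number `k`. -/
noncomputable def coeff (S : H.Solution) (n : ℕ) (α : Fin 3) (k : Fin (n + 2)) (q : Space n) : ℝ :=
  coeffs H.f H.h α k (jet (S.u n) q)

/-- The one-form on `V^{[n]}` that is the pull-back of `Θ_α^{[n]}` by `u^{[n]}`. -/
noncomputable def Θ (S : H.Solution) (n : ℕ) (α : Fin 3) (q : Space n) : Space n →L[ℝ] ℝ :=
  ∑ k : Fin (n + 2), S.coeff n α k q • ContinuousLinearMap.proj k

/-- `u^{[0]}(x, t)` is III-generic: the pull-back of `Θ₁^{[0]} ∧ Θ₂^{[0]}` vanishes nowhere. -/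
def IIIGeneric (S : H.Solution) : Prop :=
  ∀ q ∈ S.V 0, S.f 0 0 0 q * S.f 0 1 1 q - S.f 0 0 1 q * S.f 0 1 0 q ≠ 0

end Hierarchy.Solution

/-- The pull-back of a one-form by a map. -/
noncomputable def pullback {n : ℕ} (Y : Space n → Space n) (ξ : Space n → Space n →L[ℝ] ℝ)
    (q : Space n) : Space n →L[ℝ] ℝ :=
  (ξ (Y q)).comp (fderiv ℝ Y q)

/-- For `Y = (ψ, φ, φ₁, …, φₙ)`, the matrix whose row number `k` is `(ψ_k, φ_k, 0, …, 0)` for the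
variables `x, t`, and `(ψ_k, φ_k, 0, …, 1, …, 0)` for the variable `τⱼ`, with the entry `1` in
the column of `τⱼ`. -/
noncomputable def deltaMatrix {n : ℕ} (Y : Space n → Space n) (q : Space n) :
    Matrix (Fin (n + 2)) (Fin (n + 2)) ℝ :=
  Matrix.of fun k l =>
    if l = 0 then pd k (fun r => Y r 0) q
    else if l = 1 then pd k (fun r => Y r 1) q
    else if k = l then 1 else 0

/-- The determinant `Δ^{[n]}`. -/
noncomputable def Delta {n : ℕ} (Y : Space n → Space n) (q : Space n) : ℝ :=
  (deltaMatrix Y q).det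

/-- The determinant `Δ^{[n]}` with the column number `l` (counted from `0`) replaced by `c`. -/
noncomputable def DeltaCol {n : ℕ} (Y : Space n → Space n) (c : Fin (n + 2) → ℝ)
    (l : Fin (n + 2)) (q : Space n) : ℝ :=
  ((deltaMatrix Y q).updateCol l c).det

/-- The column `(f₁₁ cos μ + f₂₁ sin μ, f₁₂ cos μ + f₂₂ sin μ, h₁₁ cos μ + h₂₁ sin μ, …)`. -/
noncomputable def column {H : Hierarchy} (S : H.Solution) {n : ℕ} (μ : Space n → ℝ)
    (q : Space n) : Fin (n + 2) → ℝ :=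
  fun k => S.coeff n 0 k q * Real.cos (μ q) + S.coeff n 1 k q * Real.sin (μ q)

end PSS

/-! The structure equations say that Θ₁² + Θ₂² has curvature -1 with connection form Θ₃.
Equivalently, the linear system dr = Θ₁e₁ + Θ₂e₂, de₁ = Θ₁r + Θ₃e₂, de₂ = Θ₂r - Θ₃e₁ is completely
integrable in all the variables x, t, τ₁, …, τₙ (`connection_flat`, `exists_flat_system_solution`).
A solution with orthonormal initial value is an orthonormal frame of Minkowski space, and r takes
values in the hyperboloid model of the hyperbolic plane. III-genericity makes (x, t) ↦ r a local
immersion, so r and the τⱼ together are local coordinates.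

The map Υ matches the points of the two domains that have the same r and the same τⱼ. Two frames
with the same r differ by a rotation of the tangent plane, and μ is its angle (`exists_rotation`).
Differentiating r̂ ∘ Υ = r gives the relations for Θ₁ and Θ₂, and differentiating ê₁ ∘ Υ = e₁ cos μ
+ e₂ sin μ gives the one for Θ₃ (`pullback_Θ`). The relation for Θ₁ is a linear system for the
coefficients f̂₁₁, f̂₁₂, ĥ₁ⱼ; Cramer's rule solves it (`eq_DeltaCol_div`).

The members for different n must fit together. The frames are normalised to the identity at one base
point, so uniqueness along rays makes the frame for n + 1 restrict to the one for n. Their domains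
are a square in (x, t), the same for all n, times a star-shaped set of small τ. There the frame is
within 1/8 of the identity and Θ₁, Θ₂ are close to their values at the base point in the x- and
t-directions. Hence along each segment of constant τ a suitable linear function of the spatial
coordinates (r₁, r₂) increases, and the charts are injective on their whole domains
(`position_injOn`). Then Υ is determined by equality of positions, which is preserved by the
inclusions; compatibility follows. -/

namespace PSS

open Set Filter Topology

/-! ### Completely integrable linear systems -/

section FlatSystem

variable {W E : Type*} [NormedAddCommGroup W] [NormedSpace ℝ W]
  [NormedAddCommGroup E] [NormedSpace ℝ E]

/-- A form of Grönwall's inequality on the unit interval. -/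
theorem norm_le_of_norm_deriv_le {f f' : ℝ → E} {ε : ℝ} (hε : 0 ≤ ε)
    (hf : ∀ s ∈ Icc (0 : ℝ) 1, HasDerivWithinAt f (f' s) (Icc 0 1) s) (h0 : f 0 = 0)
    (bound : ∀ s ∈ Icc (0 : ℝ) 1, ‖f' s‖ ≤ ‖f s‖ + ε) :
    ∀ s ∈ Icc (0 : ℝ) 1, ‖f s‖ ≤ 2 * ε := by
  intro s hs
  have key := norm_le_gronwallBound_of_norm_deriv_right_le (f := f) (f' := f') (δ := 0) (K := 1)
    (ε := ε) (a := 0) (b := 1) (fun t ht => (hf t ht).continuousWithinAt)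
    (fun t ht => ((hf t ⟨ht.1, ht.2.le⟩).mono_of_mem_nhdsWithin
      (Icc_mem_nhdsGE_of_mem ht))) (by simp [h0])
    (fun t ht => by simpa using bound t ⟨ht.1, ht.2.le⟩) s hs
  refine key.trans ?_
  rw [gronwallBound_of_K_ne_0 one_ne_zero]
  -- The Grönwall bound with constant 1 is ε(eˢ - 1), and e ≤ 3 turns it into 2ε.
  have h1 : Real.exp (1 * (s - 0)) ≤ 3 := by
    have : Real.exp (1 * (s - 0)) ≤ Real.exp 1 := Real.exp_le_exp.2 (by linarith [hs.2])
    linarith [Real.exp_one_lt_d9]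
  simp only [zero_mul, div_one, zero_add]
  nlinarith

/-- Solutions of a linear differential equation with a small coefficient. -/
theorem exists_linear_ode_solution [CompleteSpace E] {B : ℝ → E →L[ℝ] E} {δ : ℝ} (hδ : δ ≤ 1 / 2)
    (hB : ContinuousOn B (Icc 0 1)) (hBδ : ∀ s ∈ Icc (0 : ℝ) 1, ‖B s‖ ≤ δ) (y₀ : E) :
    ∃ Y : ℝ → E, Y 0 = y₀ ∧
      (∀ s ∈ Icc (0 : ℝ) 1, HasDerivWithinAt Y (B s (Y s)) (Icc 0 1) s) ∧
      ∀ s ∈ Icc (0 : ℝ) 1, ‖Y s - y₀‖ ≤ 2 * (δ * ‖y₀‖) := by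
  have hδ0 : 0 ≤ δ := (norm_nonneg _).trans (hBδ 0 (by simp))
  -- Points of the ball of radius ‖y₀‖ about y₀ have norm at most 2‖y₀‖, so δ ≤ 1/2 bounds the speed
  -- by ‖y₀‖ and the solution exists on the whole unit interval.
  have hpl : IsPicardLindelof (fun s y => B s y) (tmin := 0) (tmax := 1) ⟨0, by simp⟩ y₀
      ‖y₀‖₊ 0 ‖y₀‖₊ ⟨δ, hδ0⟩ := by
    refine ⟨fun t ht => ?_, fun x _ => hB.clm_apply continuousOn_const, fun t ht x hx => ?_, ?_⟩
    · refine LipschitzWith.lipschitzOnWith ((B t).lipschitz.weaken ?_)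
      exact_mod_cast hBδ t ht
    · have h1 : ‖x‖ ≤ 2 * ‖y₀‖ := by
        have h2 : ‖x - y₀‖ ≤ ‖y₀‖ := by simpa [dist_eq_norm] using hx
        have h3 := norm_add_le (x - y₀) y₀
        rw [sub_add_cancel] at h3
        linarith
      calc ‖B t x‖ ≤ ‖B t‖ * ‖x‖ := (B t).le_opNorm x
        _ ≤ (1 / 2) * (2 * ‖y₀‖) := by
          gcongr
          exact (hBδ t ht).trans hδ
        _ = ‖y₀‖₊ := by simp
    · simp
  obtain ⟨Y, hY0, hY⟩ := hpl.exists_eq_forall_mem_Icc_hasDerivWithinAt₀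
  refine ⟨Y, hY0, hY, ?_⟩
  refine norm_le_of_norm_deriv_le (f := fun s => Y s - y₀) (by positivity)
    (fun s hs => (hY s hs).sub_const y₀) (by simp [hY0]) fun s hs => ?_
  have h3 := norm_add_le (Y s - y₀) y₀
  rw [sub_add_cancel] at h3
  calc ‖B s (Y s)‖ ≤ ‖B s‖ * ‖Y s‖ := (B s).le_opNorm _
    _ ≤ δ * (‖Y s - y₀‖ + ‖y₀‖) := by
      gcongr
      exact hBδ s hs
    _ ≤ ‖Y s - y₀‖ + δ * ‖y₀‖ := by nlinarith [norm_nonneg (Y s - y₀)]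

variable {c : W} {U : Set W} {A : W → W →L[ℝ] E →L[ℝ] E}

theorem StarConvex.ray_mem (hstar : StarConvex ℝ c U) {q : W} (hq : q ∈ U) {s : ℝ}
    (hs : s ∈ Icc (0 : ℝ) 1) : c + s • (q - c) ∈ U :=
  hstar.add_smul_sub_mem hq hs.1 hs.2

/-- The derivative of `A (c + s • (p - c)) (p - c)` in `p`. -/
noncomputable def rayDeriv (A : W → W →L[ℝ] E →L[ℝ] E) (c : W) (p : W) (s : ℝ) :
    W →L[ℝ] E →L[ℝ] E :=
  s • (fderiv ℝ A (c + s • (p - c))).flip (p - c) + A (c + s • (p - c))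

theorem hasFDerivAt_ray (hU : IsOpen U) (hA : ContDiffOn ℝ 1 A U) {p : W} {s : ℝ}
    (hp : c + s • (p - c) ∈ U) :
    HasFDerivAt (fun p => A (c + s • (p - c)) (p - c)) (rayDeriv A c p s) p := by
  have h1 : HasFDerivAt (fun p : W => p - c) (ContinuousLinearMap.id ℝ W) p :=
    (hasFDerivAt_id p).sub_const c
  have h2 : HasFDerivAt (fun p : W => c + s • (p - c)) (s • ContinuousLinearMap.id ℝ W) p :=
    (h1.const_smul s).const_add c
  have h3 : HasFDerivAt A (fderiv ℝ A (c + s • (p - c))) (c + s • (p - c)) :=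
    ((hA.differentiableOn one_ne_zero).differentiableAt (hU.mem_nhds hp)).hasFDerivAt
  have h4 : HasFDerivAt (fun p => A (c + s • (p - c)) (p - c)) _ p :=
    HasFDerivAt.clm_apply (c := fun p : W => A (c + s • (p - c))) (h3.comp p h2) h1
  refine h4.congr_fderiv ?_
  ext v y
  simp [rayDeriv, add_comm]

theorem continuousAt_rayDeriv (hU : IsOpen U) (hA : ContDiffOn ℝ 1 A U) {p : W} {s : ℝ}
    (hp : c + s • (p - c) ∈ U) :
    ContinuousAt (fun z : W × ℝ => rayDeriv A c z.1 z.2) (p, s) := by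
  have h1 : ContinuousAt (fun z : W × ℝ => c + z.2 • (z.1 - c)) (p, s) := by fun_prop
  have h2 : ContinuousAt (fun z : W × ℝ => fderiv ℝ A (c + z.2 • (z.1 - c))) (p, s) :=
    ContinuousAt.comp_of_eq (f := fun z : W × ℝ => c + z.2 • (z.1 - c))
      (((hA.continuousOn_fderiv_of_isOpen hU le_rfl).continuousAt (hU.mem_nhds hp))) h1 rfl
  have h3 : ContinuousAt (fun z : W × ℝ => A (c + z.2 • (z.1 - c))) (p, s) :=
    ContinuousAt.comp_of_eq (f := fun z : W × ℝ => c + z.2 • (z.1 - c))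
      (hA.continuousOn.continuousAt (hU.mem_nhds hp)) h1 rfl
  have h4 : ContinuousAt (fun z : W × ℝ => (fderiv ℝ A (c + z.2 • (z.1 - c))).flip) (p, s) :=
    ((ContinuousLinearMap.flipₗᵢ ℝ W W (E →L[ℝ] E)).continuous.continuousAt).comp h2
  have h5 : ContinuousAt (fun z : W × ℝ => z.1 - c) (p, s) := by fun_prop
  have h6 : ContinuousAt (fun z : W × ℝ => z.2) (p, s) := by fun_prop
  exact (h6.smul (h4.clm_apply h5)).add h3

/-- The expansion is uniform in `s`: by compactness of the interval, `rayDeriv` varies by at most ε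
on one ball about `q` for all `s`, and the mean value inequality applies on that ball. -/
theorem eventually_ray_remainder (hU : IsOpen U) (hstar : StarConvex ℝ c U)
    (hA : ContDiffOn ℝ 1 A U) {q : W} (hq : q ∈ U) {ε : ℝ} (hε : 0 < ε) :
    ∀ᶠ p in 𝓝 q, ∀ s ∈ Icc (0 : ℝ) 1,
      ‖A (c + s • (p - c)) (p - c) - A (c + s • (q - c)) (q - c) - rayDeriv A c q s (p - q)‖
        ≤ ε * ‖p - q‖ := by
  have h1 : ∀ᶠ p in 𝓝 q, ∀ s ∈ Icc (0 : ℝ) 1,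
      c + s • (p - c) ∈ U ∧ ‖rayDeriv A c p s - rayDeriv A c q s‖ ≤ ε := by
    refine isCompact_Icc.eventually_forall_of_forall_eventually
      (P := fun p s => c + s • (p - c) ∈ U ∧ ‖rayDeriv A c p s - rayDeriv A c q s‖ ≤ ε)
      fun s hs => ?_
    have hm := StarConvex.ray_mem hstar hq hs
    have hc := continuousAt_rayDeriv hU hA hm
    have hγ : ContinuousAt (fun z : W × ℝ => c + z.2 • (z.1 - c)) (q, s) := by fun_prop
    have hc' : ContinuousAt (fun z : W × ℝ => rayDeriv A c q z.2) (q, s) :=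
      ContinuousAt.comp_of_eq (f := fun z : W × ℝ => (q, z.2)) hc (by fun_prop) rfl
    have hn : ContinuousAt (fun z : W × ℝ => ‖rayDeriv A c z.1 z.2 - rayDeriv A c q z.2‖) (q, s) :=
      ContinuousAt.norm (E := W →L[ℝ] E →L[ℝ] E) (hc.sub hc')
    have hlt := hn.eventually (gt_mem_nhds (show _ < ε by
      simp only [sub_self]; exact (norm_zero (E := W →L[ℝ] E →L[ℝ] E)).trans_lt hε))
    filter_upwards [hγ.eventually (hU.mem_nhds hm), hlt] with z hz1 hz2
    exact ⟨hz1, hz2.le⟩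
  obtain ⟨r, hr, hball⟩ := Metric.eventually_nhds_iff_ball.1 h1
  filter_upwards [Metric.ball_mem_nhds q hr] with p hp s hs
  exact (convex_ball q r).norm_image_sub_le_of_norm_hasFDerivWithin_le'
    (fun x hx => (hasFDerivAt_ray hU hA (hball x hx s hs).1).hasFDerivWithinAt)
    (fun x hx => (hball x hx s hs).2) (Metric.mem_ball_self hr) hp

theorem eventually_ray_near (hU : IsOpen U) (hstar : StarConvex ℝ c U)
    (hA : ContDiffOn ℝ 1 A U) {q : W} (hq : q ∈ U) {ε : ℝ} (hε : 0 < ε) :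
    ∀ᶠ p in 𝓝 q, ∀ s ∈ Icc (0 : ℝ) 1,
      ‖A (c + s • (p - c)) (p - c) - A (c + s • (q - c)) (q - c)‖ ≤ ε := by
  refine isCompact_Icc.eventually_forall_of_forall_eventually
    (P := fun p s => ‖A (c + s • (p - c)) (p - c) - A (c + s • (q - c)) (q - c)‖ ≤ ε)
    fun s hs => ?_
  have hm := StarConvex.ray_mem hstar hq hs
  have hc : ContinuousAt (fun z : W × ℝ => A (c + z.2 • (z.1 - c)) (z.1 - c)) (q, s) := by
    have h3 : ContinuousAt (fun z : W × ℝ => A (c + z.2 • (z.1 - c))) (q, s) :=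
      ContinuousAt.comp_of_eq (f := fun z : W × ℝ => c + z.2 • (z.1 - c))
        (hA.continuousOn.continuousAt (hU.mem_nhds hm)) (by fun_prop) rfl
    exact h3.clm_apply (by fun_prop)
  have hc' : ContinuousAt (fun z : W × ℝ => A (c + z.2 • (q - c)) (q - c)) (q, s) :=
    ContinuousAt.comp_of_eq (f := fun z : W × ℝ => (q, z.2)) hc (by fun_prop) rfl
  filter_upwards [(hc.sub hc').norm.eventually (gt_mem_nhds (show _ < ε by simpa using hε))]
    with z hz
  exact hz.le

/-- A completely integrable linear system `dy = A y` has a solution with any given value at `c`. -/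
theorem exists_flat_system_solution [CompleteSpace E] (hU : IsOpen U) (hstar : StarConvex ℝ c U)
    (hc : c ∈ U) (hA : ContDiffOn ℝ 1 A U)
    (hflat : ∀ q ∈ U, ∀ v w, fderiv ℝ A q v w + (A q w).comp (A q v) =
      fderiv ℝ A q w v + (A q v).comp (A q w))
    {δ : ℝ} (hδ : δ ≤ 1 / 2)
    (hsmall : ∀ q ∈ U, ∀ s ∈ Icc (0 : ℝ) 1, ‖A (c + s • (q - c)) (q - c)‖ ≤ δ) (y₀ : E) :
    ∃ y : W → E, y c = y₀ ∧ ∀ q ∈ U,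
      HasFDerivAt y ((A q).flip (y q)) q ∧ ‖y q - y₀‖ ≤ 2 * (δ * ‖y₀‖) := by
  -- The value at `q` will come from integration along the ray from `c` to `q`. The condition `q ∈
  -- U` stands inside the existential so that a path can be chosen for every `q`; off `U` it is
  -- arbitrary.
  have hex : ∀ q : W, ∃ Y : ℝ → E, q ∈ U → Y 0 = y₀ ∧
      (∀ s ∈ Icc (0 : ℝ) 1, HasDerivWithinAt Y (A (c + s • (q - c)) (q - c) (Y s)) (Icc 0 1) s) ∧
      ∀ s ∈ Icc (0 : ℝ) 1, ‖Y s - y₀‖ ≤ 2 * (δ * ‖y₀‖) := by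
    intro q
    by_cases hq : q ∈ U
    · obtain ⟨Y, hY⟩ := exists_linear_ode_solution (B := fun s => A (c + s • (q - c)) (q - c)) hδ
        ((hA.continuousOn.comp (f := fun s : ℝ => c + s • (q - c)) (by fun_prop)
          fun s hs => StarConvex.ray_mem hstar hq hs).clm_apply continuousOn_const)
        (hsmall q hq) y₀
      exact ⟨Y, fun _ => hY⟩
    · exact ⟨0, fun h => absurd h hq⟩
  choose Y hY using hex
  have h01 : (1 : ℝ) ∈ Icc (0 : ℝ) 1 := by simp
  refine ⟨fun q => Y q 1, ?_, fun q hq => ⟨?_, (hY q hq).2.2 1 h01⟩⟩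
  · obtain ⟨h0, hd, -⟩ := hY c hc
    have := norm_le_of_norm_deriv_le (f := fun s => Y c s - y₀) le_rfl
      (fun s hs => (hd s hs).sub_const y₀) (by simp [h0]) (fun s hs => by simp) 1 h01
    simpa [sub_eq_zero] using this
  obtain ⟨hq0, hqd, -⟩ := hY q hq
  have hYq : ContinuousOn (Y q) (Icc 0 1) := fun s hs => (hqd s hs).continuousWithinAt
  obtain ⟨N, hN⟩ := isCompact_Icc.exists_bound_of_continuousOn hYq
  have hAγ : ContinuousOn (fun s : ℝ => A (c + s • (q - c))) (Icc 0 1) :=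
    hA.continuousOn.comp (f := fun s : ℝ => c + s • (q - c)) (by fun_prop)
      fun s hs => StarConvex.ray_mem hstar hq hs
  obtain ⟨M, hM⟩ := isCompact_Icc.exists_bound_of_continuousOn (E := W →L[ℝ] E →L[ℝ] E) hAγ
  have hN0 : 0 ≤ N := (norm_nonneg _).trans (hN 0 (by simp))
  have hM0 : 0 ≤ M := (norm_nonneg _).trans (hM 0 (by simp))
  rw [hasFDerivAt_iff_isLittleO, Asymptotics.isLittleO_iff]
  intro η hη
  obtain ⟨ε, hε, hεη⟩ : ∃ ε : ℝ, 0 < ε ∧ 2 * (ε * ((1 + M) * N)) ≤ η := by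
    refine ⟨η / (2 * ((1 + M) * N) + 1), by positivity, ?_⟩
    rw [div_mul_eq_mul_div, mul_div_assoc', div_le_iff₀ (by positivity)]
    nlinarith
  filter_upwards [eventually_ray_remainder hU hstar hA hq hε,
    eventually_ray_near hU hstar hA hq hε, hU.mem_nhds hq] with p hrem hnear hp
  obtain ⟨hp0, hpd, -⟩ := hY p hp
  set w := p - q with hw
  -- By flatness, s ↦ A(γ s)(s w)(Y q s), with γ the ray to `q`, solves the equation of variations
  -- of the ray equation. The difference below therefore satisfies that equation up to an error ε‖w‖
  -- times a constant, and Grönwall makes it o(‖w‖). At s = 1 this is the claimed derivative.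
  have key := norm_le_of_norm_deriv_le
    (f := fun s => Y p s - Y q s - A (c + s • (q - c)) (s • w) (Y q s))
    (f' := fun s => A (c + s • (p - c)) (p - c) (Y p s) - A (c + s • (q - c)) (q - c) (Y q s) -
      ((fderiv ℝ A (c + s • (q - c)) (q - c) (s • w) + A (c + s • (q - c)) w) (Y q s) +
        A (c + s • (q - c)) (s • w) (A (c + s • (q - c)) (q - c) (Y q s))))
    (ε := ε * ((1 + M) * N) * ‖w‖) (by positivity) ?_ (by simp [hp0, hq0]) ?_ 1 h01
  · calc _ = ‖Y p 1 - Y q 1 - A (c + (1 : ℝ) • (q - c)) ((1 : ℝ) • w) (Y q 1)‖ := by simp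
      _ ≤ _ := key
      _ = 2 * (ε * ((1 + M) * N)) * ‖w‖ := by ring
      _ ≤ η * ‖w‖ := by gcongr
  · intro s hs
    refine ((hpd s hs).sub (hqd s hs)).sub ?_
    have hm := StarConvex.ray_mem hstar hq hs
    have h3 : HasFDerivAt A (fderiv ℝ A (c + s • (q - c))) (c + s • (q - c)) :=
      ((hA.differentiableOn one_ne_zero).differentiableAt (hU.mem_nhds hm)).hasFDerivAt
    have h2 : HasDerivAt (fun s : ℝ => c + s • (q - c)) (q - c) s := by
      simpa using ((hasDerivAt_id s).smul_const (q - c)).const_add c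
    have h1 : HasDerivAt (fun s : ℝ => s • w) w s := by
      simpa using (hasDerivAt_id s).smul_const w
    have h4 : HasDerivAt (fun s : ℝ => A (c + s • (q - c)))
        (fderiv ℝ A (c + s • (q - c)) (q - c)) s :=
      HasFDerivAt.comp_hasDerivAt (F := W) (E := W →L[ℝ] E →L[ℝ] E) (l := A) s h3 h2
    have h5 : HasDerivAt (fun s : ℝ => A (c + s • (q - c)) (s • w))
        (fderiv ℝ A (c + s • (q - c)) (q - c) (s • w) + A (c + s • (q - c)) w) s :=
      h4.clm_apply h1
    exact h5.hasDerivWithinAt.clm_apply (hqd s hs)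
  · intro s hs
    have hm := StarConvex.ray_mem hstar hq hs
    have hf := congrArg (fun T => T (Y q s)) (hflat _ hm (q - c) (s • w))
    simp only [_root_.add_apply, ContinuousLinearMap.comp_apply] at hf
    set a := A (c + s • (q - c)) with ha
    set bp := A (c + s • (p - c)) (p - c) with hbp
    set d := Y p s - Y q s - a (s • w) (Y q s) with hd
    have e1 : bp (Y p s) - a (q - c) (Y q s) -
        ((fderiv ℝ A (c + s • (q - c)) (q - c) (s • w) + a w) (Y q s) +
          a (s • w) (a (q - c) (Y q s))) =
        bp d + ((bp - a (q - c) - rayDeriv A c q s w) (Y q s) +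
          (bp - a (q - c)) (a (s • w) (Y q s))) := by
      have e2 : Y p s = d + Y q s + a (s • w) (Y q s) := by rw [hd]; abel
      have e3 : rayDeriv A c q s w =
          fderiv ℝ A (c + s • (q - c)) (s • w) (q - c) + a w := by
        simp [rayDeriv, ha]
      rw [e2, e3]
      simp only [map_add, _root_.add_apply, _root_.sub_apply]
      -- Flatness exchanges the direction of the ray and the displacement `s • w`; it is used
      -- nowhere else.
      have e4 : fderiv ℝ A (c + s • (q - c)) (q - c) (s • w) (Y q s) =
          fderiv ℝ A (c + s • (q - c)) (s • w) (q - c) (Y q s) +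
            a (q - c) (a (s • w) (Y q s)) - a (s • w) (a (q - c) (Y q s)) := by
        rw [eq_sub_iff_add_eq, hf]
      rw [e4]
      abel
    change ‖bp (Y p s) - a (q - c) (Y q s) -
        ((fderiv ℝ A (c + s • (q - c)) (q - c) (s • w) + a w) (Y q s) +
          a (s • w) (a (q - c) (Y q s)))‖ ≤ ‖d‖ + _
    rw [e1]
    have hs1 : ‖s‖ ≤ 1 := by rw [Real.norm_of_nonneg hs.1]; exact hs.2
    have b1 : ‖bp d‖ ≤ ‖d‖ :=
      (bp.le_of_opNorm_le ((hsmall p hp s hs).trans (hδ.trans (by norm_num))) d).trans_eq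
        (one_mul _)
    have b2 : ‖(bp - a (q - c) - rayDeriv A c q s w) (Y q s)‖ ≤ ε * ‖w‖ * N :=
      (ContinuousLinearMap.le_of_opNorm_le _ (hrem s hs) _).trans (by gcongr; exact hN s hs)
    have b3 : ‖(bp - a (q - c)) (a (s • w) (Y q s))‖ ≤ ε * (M * (1 * ‖w‖) * N) := by
      refine (ContinuousLinearMap.le_of_opNorm_le _ (hnear s hs) _).trans ?_
      gcongr
      refine (ContinuousLinearMap.le_opNorm _ _).trans ?_
      gcongr
      · refine (ContinuousLinearMap.le_opNorm _ _).trans ?_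
        gcongr
        · exact hM s hs
        · rw [norm_smul]; gcongr
      · exact hN s hs
    calc _ ≤ ‖bp d‖ + (‖(bp - a (q - c) - rayDeriv A c q s w) (Y q s)‖ +
          ‖(bp - a (q - c)) (a (s • w) (Y q s))‖) :=
          (norm_add_le _ _).trans (by gcongr; exact norm_add_le _ _)
      _ ≤ ‖d‖ + (ε * ‖w‖ * N + ε * (M * (1 * ‖w‖) * N)) := by gcongr
      _ = ‖d‖ + ε * ((1 + M) * N) * ‖w‖ := by ring

/-- Two solutions of linear systems that are related by a linear map of the base agree. -/
theorem flat_system_solution_comp {W' : Type*} [NormedAddCommGroup W'] [NormedSpace ℝ W']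
    {U' : Set W'} {A' : W' → W' →L[ℝ] E →L[ℝ] E} {y : W → E} {y' : W' → E}
    (hstar : StarConvex ℝ c U) (hA : ContinuousOn A U) (ι : W →L[ℝ] W')
    (hι : ∀ q ∈ U, ι q ∈ U')
    (hAA' : ∀ q ∈ U, ∀ v, A' (ι q) (ι v) = A q v)
    (hy : ∀ q ∈ U, HasFDerivAt y ((A q).flip (y q)) q)
    (hy' : ∀ q ∈ U', HasFDerivAt y' ((A' q).flip (y' q)) q) (h0 : y' (ι c) = y c) :
    ∀ q ∈ U, y' (ι q) = y q := by
  intro q hq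
  have hAγ : ContinuousOn (fun s : ℝ => A (c + s • (q - c)) (q - c)) (Icc 0 1) :=
    (hA.comp (f := fun s : ℝ => c + s • (q - c)) (by fun_prop)
      fun s hs => StarConvex.ray_mem hstar hq hs).clm_apply continuousOn_const
  obtain ⟨M, hM⟩ := isCompact_Icc.exists_bound_of_continuousOn hAγ
  have hγ : ∀ s : ℝ, HasDerivAt (fun s : ℝ => c + s • (q - c)) (q - c) s := fun s => by
    simpa using ((hasDerivAt_id s).smul_const (q - c)).const_add c
  have hd : ∀ s ∈ Icc (0 : ℝ) 1,
      HasDerivAt (fun s : ℝ => y (c + s • (q - c)))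
        (A (c + s • (q - c)) (q - c) (y (c + s • (q - c)))) s := fun s hs => by
    exact (hy _ (StarConvex.ray_mem hstar hq hs)).comp_hasDerivAt s (hγ s)
  have hd' : ∀ s ∈ Icc (0 : ℝ) 1,
      HasDerivAt (fun s : ℝ => y' (ι (c + s • (q - c))))
        (A (c + s • (q - c)) (q - c) (y' (ι (c + s • (q - c))))) s := fun s hs => by
    have hm := StarConvex.ray_mem hstar hq hs
    have h1 := (hy' _ (hι _ hm)).comp_hasDerivAt s
      (ι.hasFDerivAt.comp_hasDerivAt s (hγ s))
    rw [ContinuousLinearMap.flip_apply, hAA' _ hm] at h1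
    exact h1
  have := ODE_solution_unique_of_mem_Icc_right
    (v := fun s z => A (c + s • (q - c)) (q - c) z) (s := fun _ => univ) (K := ⟨|M|, abs_nonneg M⟩)
    (f := fun s : ℝ => y' (ι (c + s • (q - c)))) (g := fun s : ℝ => y (c + s • (q - c)))
    (a := 0) (b := 1)
    (fun t ht => LipschitzWith.lipschitzOnWith
      ((A (c + t • (q - c)) (q - c)).lipschitz.weaken
        (NNReal.coe_le_coe.1 ((hM t ⟨ht.1, ht.2.le⟩).trans (le_abs_self M)))))
    (fun t ht => (hd' t ht).continuousAt.continuousWithinAt)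
    (fun t ht => (hd' t ⟨ht.1, ht.2.le⟩).hasDerivWithinAt) (fun _ _ => mem_univ _)
    (fun t ht => (hd t ht).continuousAt.continuousWithinAt)
    (fun t ht => (hd t ⟨ht.1, ht.2.le⟩).hasDerivWithinAt) (fun _ _ => mem_univ _)
    (by simpa using h0) (show (1 : ℝ) ∈ Icc (0 : ℝ) 1 by simp)
  simpa using this

/-- Solutions of smooth linear systems are smooth. -/
theorem contDiffOn_flat_system_solution {y : W → E} (hU : IsOpen U) (hA : ContDiffOn ℝ ∞ A U)
    (hy : ∀ q ∈ U, HasFDerivAt y ((A q).flip (y q)) q) : ContDiffOn ℝ ∞ y U := by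
  rw [contDiffOn_infty]
  intro n
  -- Bootstrap: if `y` is of class Cⁿ, then so is its derivative `(A q).flip (y q)`.
  induction n with
  | zero =>
    exact contDiffOn_zero.2 fun q hq => (hy q hq).continuousAt.continuousWithinAt
  | succ n ih =>
    rw [Nat.cast_succ, contDiffOn_succ_iff_fderiv_of_isOpen hU]
    refine ⟨fun q hq => (hy q hq).differentiableAt.differentiableWithinAt, by simp, ?_⟩
    have h2 : ContDiff ℝ n (fun T : W →L[ℝ] E →L[ℝ] E => T.flip) :=
      IsBoundedLinearMap.contDiff
        ⟨⟨fun _ _ => rfl, fun _ _ => rfl⟩, 1, one_pos, fun T => by rw [T.opNorm_flip, one_mul]⟩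
    have h1 : ContDiffOn ℝ n (fun q => (A q).flip (y q)) U :=
      ContDiffOn.clm_apply (f := fun q => (A q).flip)
        (h2.comp_contDiffOn (hA.of_le (show (n : WithTop ℕ∞) ≤ ∞ from mod_cast le_top))) ih
    exact h1.congr fun q hq => (hy q hq).fderiv

end FlatSystem

/-! ### Differential functions and total derivatives in finitely many coordinates -/

section DifferentialFunctions

/-- The direction of the independent variable number `k` in the truncated jets. -/
def dirVar (m k : ℕ) : (Fin m → ℝ) × (Fin m → ℝ) :=
  (fun l => if (l : ℕ) = k then 1 else 0, 0)

/-- The direction of the jet coordinate number `j` in the truncated jets. -/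
def dirJet (m j : ℕ) : (Fin m → ℝ) × (Fin m → ℝ) :=
  (0, fun l => if (l : ℕ) = j then 1 else 0)

/-- This makes the sums over all jet coordinates in the total derivatives finite. -/
theorem dirJet_eq_zero {m j : ℕ} (h : m ≤ j) : dirJet m j = 0 := by
  ext l
  · rfl
  · have : (l : ℕ) ≠ j := (l.2.trans_le h).ne
    simp [dirJet, this]

variable {U : Set Jet} {g : Jet → ℝ} {m : ℕ} {G : (Fin m → ℝ) × (Fin m → ℝ) → ℝ}

theorem partialVar_eq (hU : IsOpen U)
    (hG : ∀ p ∈ U, g p = G (truncate m p) ∧ ContDiffAt ℝ ∞ G (truncate m p))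
    {p : Jet} (hp : p ∈ U) (k : ℕ) :
    partialVar k g p = fderiv ℝ G (truncate m p) (dirVar m k) := by
  set γ : ℝ → Jet := fun s => (Function.update p.1 k s, p.2) with hγ
  have hγp : γ (p.1 k) = p := by simp [hγ]
  have hγc : Continuous γ := by
    refine Continuous.prodMk ?_ continuous_const
    exact continuous_const.update k continuous_id
  have hev : ∀ᶠ s in 𝓝 (p.1 k), γ s ∈ U :=
    hγc.continuousAt.eventually (by rw [hγp]; exact hU.mem_nhds hp)
  have hT : ∀ s, truncate m (γ s) = truncate m p + (s - p.1 k) • dirVar m k := by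
    intro s
    ext l
    · by_cases h : (l : ℕ) = k
      · simp [hγ, truncate, dirVar, h]
      · simp [hγ, truncate, dirVar, h]
    · simp [hγ, truncate, dirVar]
  have hd : HasDerivAt (fun s => truncate m p + (s - p.1 k) • dirVar m k) (dirVar m k)
      (p.1 k) := by
    simpa using (((hasDerivAt_id (p.1 k)).sub_const (p.1 k)).smul_const (dirVar m k)).const_add
      (truncate m p)
  have hG' : HasFDerivAt G (fderiv ℝ G (truncate m p)) (truncate m p) :=
    ((hG p hp).2.differentiableAt (by simp)).hasFDerivAt
  have h1 := HasFDerivAt.comp_hasDerivAt_of_eq (p.1 k) hG' hd (by simp)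
  refine HasDerivAt.deriv (h1.congr_of_eventuallyEq ?_)
  filter_upwards [hev] with s hs
  change g (γ s) = _
  rw [(hG _ hs).1, hT]
  rfl

theorem partialJet_eq (hU : IsOpen U)
    (hG : ∀ p ∈ U, g p = G (truncate m p) ∧ ContDiffAt ℝ ∞ G (truncate m p))
    {p : Jet} (hp : p ∈ U) (j : ℕ) :
    partialJet j g p = fderiv ℝ G (truncate m p) (dirJet m j) := by
  set γ : ℝ → Jet := fun s => (p.1, Function.update p.2 j s) with hγ
  have hγp : γ (p.2 j) = p := by simp [hγ]
  have hγc : Continuous γ := by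
    refine Continuous.prodMk continuous_const ?_
    exact continuous_const.update j continuous_id
  have hev : ∀ᶠ s in 𝓝 (p.2 j), γ s ∈ U :=
    hγc.continuousAt.eventually (by rw [hγp]; exact hU.mem_nhds hp)
  have hT : ∀ s, truncate m (γ s) = truncate m p + (s - p.2 j) • dirJet m j := by
    intro s
    ext l
    · simp [hγ, truncate, dirJet]
    · by_cases h : (l : ℕ) = j
      · simp [hγ, truncate, dirJet, h]
      · simp [hγ, truncate, dirJet, h]
  have hd : HasDerivAt (fun s => truncate m p + (s - p.2 j) • dirJet m j) (dirJet m j)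
      (p.2 j) := by
    simpa using (((hasDerivAt_id (p.2 j)).sub_const (p.2 j)).smul_const (dirJet m j)).const_add
      (truncate m p)
  have hG' : HasFDerivAt G (fderiv ℝ G (truncate m p)) (truncate m p) :=
    ((hG p hp).2.differentiableAt (by simp)).hasFDerivAt
  have h1 := HasFDerivAt.comp_hasDerivAt_of_eq (p.2 j) hG' hd (by simp)
  refine HasDerivAt.deriv (h1.congr_of_eventuallyEq ?_)
  filter_upwards [hev] with s hs
  change g (γ s) = _
  rw [(hG _ hs).1, hT]
  rfl

theorem finsum_partialJet_eq (hU : IsOpen U)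
    (hG : ∀ p ∈ U, g p = G (truncate m p) ∧ ContDiffAt ℝ ∞ G (truncate m p))
    {p : Jet} (hp : p ∈ U) (c : ℕ → ℝ) :
    ∑ᶠ j : ℕ, c j * partialJet j g p =
      ∑ j : Fin m, c j * fderiv ℝ G (truncate m p) (dirJet m j) := by
  rw [Fin.sum_univ_eq_sum_range fun j => c j * fderiv ℝ G (truncate m p) (dirJet m j)]
  simp only [partialJet_eq hU hG hp]
  refine finsum_eq_sum_of_support_subset _ fun j hj => ?_
  by_contra h
  simp only [Finset.coe_range, mem_Iio, not_lt] at h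
  simp [dirJet_eq_zero h] at hj

/-- The projection of truncated jets to truncated jets of smaller length. -/
def shorten (m : ℕ) :
    ((Fin (m + 1) → ℝ) × (Fin (m + 1) → ℝ)) →L[ℝ] (Fin m → ℝ) × (Fin m → ℝ) :=
  ContinuousLinearMap.prodMap
    (ContinuousLinearMap.pi fun l => ContinuousLinearMap.proj l.castSucc)
    (ContinuousLinearMap.pi fun l => ContinuousLinearMap.proj l.castSucc)

theorem IsDifferentialFunction.totalX (hU : IsOpen U) (hg : IsDifferentialFunction U g) :
    IsDifferentialFunction U (totalX g) := by
  obtain ⟨m, G, hG⟩ := hg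
  -- `D_x` raises the order by one: the derivative in u_{xʲ} is multiplied by u_{xʲ⁺¹}, which is
  -- `z.2 j.succ`.
  refine ⟨m + 1, fun z => fderiv ℝ G (shorten m z) (dirVar m 0) +
    ∑ j : Fin m, z.2 j.succ * fderiv ℝ G (shorten m z) (dirJet m j), fun p hp => ⟨?_, ?_⟩⟩
  · rw [PSS.totalX, partialVar_eq hU hG hp, finsum_partialJet_eq hU hG hp]
    rfl
  · have h1 : ContDiffAt ℝ ∞ (fun z => fderiv ℝ G (shorten m z)) (truncate (m + 1) p) :=
      ((hG p hp).2.fderiv_right (m := ∞) (by simp)).comp (truncate (m + 1) p)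
        (shorten m).contDiff.contDiffAt
    refine (h1.clm_apply contDiffAt_const).add (ContDiffAt.sum fun j _ => ?_)
    exact ContDiffAt.mul (by fun_prop) (h1.clm_apply contDiffAt_const)

theorem IsDifferentialFunction.totalX_iterate (hU : IsOpen U) (hg : IsDifferentialFunction U g)
    (j : ℕ) : IsDifferentialFunction U (PSS.totalX^[j] g) := by
  induction j with
  | zero => exact hg
  | succ j ih =>
    rw [Function.iterate_succ_apply']
    exact ih.totalX hU

end DifferentialFunctions

/-! ### Jets of functions and the chain rule -/

section Pullback

variable {n : ℕ}

/-- The coordinate number `k` of `extend q` as a linear form in `q`. -/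
noncomputable def extendL (n k : ℕ) : Space n →L[ℝ] ℝ :=
  if hk : k < n + 2 then ContinuousLinearMap.proj ⟨k, hk⟩ else 0

theorem extendL_apply (k : ℕ) (q : Space n) : extendL n k q = extend q k := by
  unfold extendL extend
  split_ifs <;> rfl

/-- The inclusion `incl` as a continuous linear map. -/
noncomputable def inclL (n : ℕ) : Space n →L[ℝ] Space (n + 1) :=
  ContinuousLinearMap.pi fun k => extendL n k

theorem inclL_apply (q : Space n) : inclL n q = incl q := by
  ext k
  exact extendL_apply _ _

theorem extend_of_lt (q : Space n) {k : ℕ} (hk : k < n + 2) : extend q k = q ⟨k, hk⟩ := by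
  simp [extend, hk]

theorem extend_incl (q : Space n) : extend (incl q) = extend q := by
  ext k
  by_cases hk : k < n + 3
  · rw [extend_of_lt _ hk]
    rfl
  · have h2 : ¬ k < n + 2 := by omega
    simp [extend, hk, h2]

theorem extend_single (a : Fin (n + 2)) (k : ℕ) :
    extend (Pi.single a 1 : Space n) k = if k = a then 1 else 0 := by
  unfold extend
  split_ifs with h1 h2 h2
  · subst h2; simp
  · rw [Pi.single_eq_of_ne]
    intro h
    exact h2 (by rw [← h])
  · exact absurd (h2 ▸ a.2) h1
  · rfl

theorem incl_single (a : Fin (n + 2)) :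
    incl (Pi.single a 1 : Space n) = Pi.single a.castSucc 1 := by
  ext k
  rw [incl, extend_single, Pi.single_apply]
  simp [Fin.ext_iff]

theorem contDiffOn_pd {V : Set (Space n)} (hV : IsOpen V) {g : Space n → ℝ}
    (hg : ContDiffOn ℝ ∞ g V) (k : Fin (n + 2)) : ContDiffOn ℝ ∞ (pd k g) V :=
  (hg.fderiv_of_isOpen hV (m := ∞) (by simp)).clm_apply contDiffOn_const

theorem contDiffOn_pd_iterate {V : Set (Space n)} (hV : IsOpen V) {g : Space n → ℝ}
    (hg : ContDiffOn ℝ ∞ g V) (k : Fin (n + 2)) (j : ℕ) : ContDiffOn ℝ ∞ ((pd k)^[j] g) V := by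
  induction j with
  | zero => exact hg
  | succ j ih =>
    rw [Function.iterate_succ_apply']
    exact contDiffOn_pd hV ih k

theorem pd_congr {V : Set (Space n)} (hV : IsOpen V) {g g' : Space n → ℝ} (h : EqOn g g' V)
    (k : Fin (n + 2)) : EqOn (pd k g) (pd k g') V := fun q hq => by
  rw [pd, pd, Filter.EventuallyEq.fderiv_eq (h.eventuallyEq_of_mem (hV.mem_nhds hq))]

theorem pd_comm {V : Set (Space n)} (hV : IsOpen V) {g : Space n → ℝ}
    (hg : ContDiffOn ℝ ∞ g V) (a b : Fin (n + 2)) : EqOn (pd a (pd b g)) (pd b (pd a g)) V := by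
  intro q hq
  have hgq : ContDiffAt ℝ ∞ g q := hg.contDiffAt (hV.mem_nhds hq)
  have hd : DifferentiableAt ℝ (fderiv ℝ g) q :=
    (hgq.fderiv_right (m := ∞) (by simp)).differentiableAt (by simp)
  have h1 : ∀ a b : Fin (n + 2), pd a (pd b g) q =
      fderiv ℝ (fderiv ℝ g) q (Pi.single a 1) (Pi.single b 1) := fun a b => by
    change fderiv ℝ (fun r => fderiv ℝ g r (Pi.single b 1)) q (Pi.single a 1) = _
    rw [fderiv_clm_apply hd (by fun_prop)]
    simp
  rw [h1, h1]
  exact (hgq.isSymmSndFDerivAt (by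
    rw [minSmoothness_of_isRCLikeNormedField]
    exact WithTop.coe_le_coe.2 (le_top (a := (2 : ℕ∞))))).eq _ _

theorem pd_pd_iterate {V : Set (Space n)} (hV : IsOpen V) {g : Space n → ℝ}
    (hg : ContDiffOn ℝ ∞ g V) (a b : Fin (n + 2)) (j : ℕ) :
    EqOn (pd a ((pd b)^[j] g)) ((pd b)^[j] (pd a g)) V := by
  induction j with
  | zero => exact fun _ _ => rfl
  | succ j ih =>
    rw [Function.iterate_succ_apply', Function.iterate_succ_apply']
    exact (pd_comm hV (contDiffOn_pd_iterate hV hg b j) a b).trans (pd_congr hV ih b)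

theorem hasFDerivAt_truncate_jet {V : Set (Space n)} (hV : IsOpen V) {u : Space n → ℝ}
    (hu : ContDiffOn ℝ ∞ u V) {q : Space n} (hq : q ∈ V) (m : ℕ) :
    HasFDerivAt (fun q => truncate m (jet u q))
      ((ContinuousLinearMap.pi fun k : Fin m => extendL n k).prod
        (ContinuousLinearMap.pi fun j : Fin m => fderiv ℝ ((pd 0)^[j] u) q)) q := by
  refine HasFDerivAt.prodMk ?_ ?_
  · refine (ContinuousLinearMap.hasFDerivAt
      (ContinuousLinearMap.pi fun k : Fin m => extendL n k)).congr_of_eventuallyEq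
        (Eventually.of_forall fun q => ?_)
    ext k
    exact (extendL_apply _ _).symm
  · exact hasFDerivAt_pi.2 fun j =>
      (((contDiffOn_pd_iterate hV hu 0 j).contDiffAt (hV.mem_nhds hq)).differentiableAt
        (by simp)).hasFDerivAt

theorem contDiffOn_truncate_jet {V : Set (Space n)} (hV : IsOpen V) {u : Space n → ℝ}
    (hu : ContDiffOn ℝ ∞ u V) (m : ℕ) : ContDiffOn ℝ ∞ (fun q => truncate m (jet u q)) V := by
  refine ContDiffOn.prodMk (contDiffOn_pi.2 fun k => ?_)
    (contDiffOn_pi.2 fun j => contDiffOn_pd_iterate hV hu 0 j)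
  exact ((extendL n k).contDiff.contDiffOn).congr fun q _ => (extendL_apply _ _).symm

variable {U : Set Jet} {g : Jet → ℝ}

theorem IsDifferentialFunction.contDiffOn_jet (hg : IsDifferentialFunction U g)
    {V : Set (Space n)} (hV : IsOpen V) {u : Space n → ℝ} (hu : ContDiffOn ℝ ∞ u V)
    (hVU : ∀ q ∈ V, jet u q ∈ U) : ContDiffOn ℝ ∞ (fun q => g (jet u q)) V := by
  obtain ⟨m, G, hG⟩ := hg
  refine ContDiffOn.congr (f := fun q => G (truncate m (jet u q))) (fun q hq => ?_)
    fun q hq => (hG _ (hVU q hq)).1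
  exact (hG _ (hVU q hq)).2.comp_contDiffWithinAt q (contDiffOn_truncate_jet hV hu m q hq)

/-- The chain rule for the pull-back of a differential function. -/
theorem pd_comp_jet (hU : IsOpen U) (hg : IsDifferentialFunction U g)
    {V : Set (Space n)} (hV : IsOpen V) {u : Space n → ℝ} (hu : ContDiffOn ℝ ∞ u V)
    (hVU : ∀ q ∈ V, jet u q ∈ U) {q : Space n} (hq : q ∈ V) (a : Fin (n + 2)) :
    pd a (fun q => g (jet u q)) q = partialVar a g (jet u q) +
      ∑ᶠ j : ℕ, pd a ((pd 0)^[j] u) q * partialJet j g (jet u q) := by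
  obtain ⟨m, G, hG⟩ := hg
  rw [partialVar_eq hU hG (hVU q hq), finsum_partialJet_eq hU hG (hVU q hq)]
  have hG' : HasFDerivAt G (fderiv ℝ G (truncate m (jet u q))) (truncate m (jet u q)) :=
    ((hG _ (hVU q hq)).2.differentiableAt (by simp)).hasFDerivAt
  have h1 := hG'.comp q (hasFDerivAt_truncate_jet hV hu hq m)
  have h2 : HasFDerivAt (fun q => g (jet u q)) _ q := h1.congr_of_eventuallyEq
    (Filter.eventually_of_mem (hV.mem_nhds hq) fun r hr => (hG _ (hVU r hr)).1)
  have h3 : ((ContinuousLinearMap.pi fun k : Fin m => extendL n k).prod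
        (ContinuousLinearMap.pi fun j : Fin m => fderiv ℝ ((pd 0)^[j] u) q)) (Pi.single a 1) =
      dirVar m a + ∑ j : Fin m, pd a ((pd 0)^[j] u) q • dirJet m j := by
    ext l
    · simp [dirVar, dirJet, extendL_apply, extend_single, Prod.fst_sum]
    · simp [dirVar, dirJet, Prod.snd_sum, pd, Fin.val_inj]
  rw [pd, h2.fderiv, ContinuousLinearMap.comp_apply, h3, map_add, map_sum]
  simp

theorem pd_zero_comp_jet (hU : IsOpen U) (hg : IsDifferentialFunction U g)
    {V : Set (Space n)} (hV : IsOpen V) {u : Space n → ℝ} (hu : ContDiffOn ℝ ∞ u V)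
    (hVU : ∀ q ∈ V, jet u q ∈ U) {q : Space n} (hq : q ∈ V) :
    pd 0 (fun q => g (jet u q)) q = totalX g (jet u q) := by
  rw [pd_comp_jet hU hg hV hu hVU hq, totalX]
  simp only [jet, Function.iterate_succ_apply']
  rfl

theorem pd_zero_iterate_comp_jet (hU : IsOpen U) (hg : IsDifferentialFunction U g)
    {V : Set (Space n)} (hV : IsOpen V) {u : Space n → ℝ} (hu : ContDiffOn ℝ ∞ u V)
    (hVU : ∀ q ∈ V, jet u q ∈ U) (j : ℕ) :
    EqOn ((pd 0)^[j] fun q => g (jet u q)) (fun q => (totalX^[j] g) (jet u q)) V := by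
  induction j with
  | zero => exact fun _ _ => rfl
  | succ j ih =>
    intro q hq
    rw [Function.iterate_succ_apply', Function.iterate_succ_apply', pd_congr hV ih 0 hq]
    exact pd_zero_comp_jet hU (hg.totalX_iterate hU j) hV hu hVU hq

end Pullback

/-! ### Structure equations along a solution -/

namespace Hierarchy

theorem coeffs_smooth (H : Hierarchy) (α : Fin 3) (k : ℕ) :
    IsDifferentialFunction H.dom (coeffs H.f H.h α k) := by
  match k with
  | 0 => exact H.f_smooth α 0
  | 1 => exact H.f_smooth α 1
  | j + 2 => exact H.h_smooth α j

namespace Solution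

variable {H : Hierarchy} (S : H.Solution) {n : ℕ}

/-- On a solution, ∂/∂τᵢ commutes with the x-derivatives, so u_{τᵢ} = Fᵢ turns the τᵢ-derivative of
u_{xʲ} into D_xʲFᵢ. Thus `d_H` becomes the ordinary exterior derivative of the pulled-back forms. -/
theorem pd_comp_jet {g : Jet → ℝ} (hg : IsDifferentialFunction H.dom g) {q : Space n}
    (hq : q ∈ S.V n) (a : Fin (n + 2)) :
    pd a (fun q => g (jet (S.u n) q)) q = totalD H.F a g (jet (S.u n) q) := by
  induction a using Fin.cases with
  | zero => exact pd_zero_comp_jet H.isOpen_dom hg (S.isOpen_V n) (S.smooth n) (S.jet_mem n) hq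
  | succ i =>
    rw [PSS.pd_comp_jet H.isOpen_dom hg (S.isOpen_V n) (S.smooth n) (S.jet_mem n) hq,
      Fin.val_succ, totalD, totalTau]
    congr 1
    refine finsum_congr fun j => ?_
    congr 1
    rw [pd_pd_iterate (S.isOpen_V n) (S.smooth n) i.succ 0 j hq]
    refine Eq.trans ?_ (pd_zero_iterate_comp_jet H.isOpen_dom (H.F_smooth i) (S.isOpen_V n)
      (S.smooth n) (S.jet_mem n) j hq)
    have h1 : EqOn (pd i.succ (S.u n)) (fun q => H.F i (jet (S.u n) q)) (S.V n) :=
      fun q hq => S.equation n i q hq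
    have h2 : ∀ j, EqOn ((pd 0)^[j] (pd i.succ (S.u n)))
        ((pd 0)^[j] fun q => H.F i (jet (S.u n) q)) (S.V n) := by
      intro j
      induction j with
      | zero => exact h1
      | succ j ih =>
        rw [Function.iterate_succ_apply', Function.iterate_succ_apply']
        exact pd_congr (S.isOpen_V n) ih 0
    exact h2 j hq

theorem contDiffOn_coeff (α : Fin 3) (k : Fin (n + 2)) :
    ContDiffOn ℝ ∞ (S.coeff n α k) (S.V n) :=
  (H.coeffs_smooth α k).contDiffOn_jet (S.isOpen_V n) (S.smooth n) (S.jet_mem n)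

theorem pd_coeff_sub {q : Space n} (hq : q ∈ S.V n) (α : Fin 3) (a b : Fin (n + 2)) :
    pd a (S.coeff n α b) q - pd b (S.coeff n α a) q =
      dH H.F (coeffs H.f H.h α) a b (jet (S.u n) q) := by
  rw [dH, ← S.pd_comp_jet (H.coeffs_smooth α b) hq a, ← S.pd_comp_jet (H.coeffs_smooth α a) hq b]
  rfl

theorem coeff_structure_one {q : Space n} (hq : q ∈ S.V n) (a b : Fin (n + 2)) :
    pd a (S.coeff n 0 b) q - pd b (S.coeff n 0 a) q =
      S.coeff n 2 a q * S.coeff n 1 b q - S.coeff n 2 b q * S.coeff n 1 a q := by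
  rw [S.pd_coeff_sub hq, H.structure_one n a b _ (S.jet_mem n q hq)]
  rfl

theorem coeff_structure_two {q : Space n} (hq : q ∈ S.V n) (a b : Fin (n + 2)) :
    pd a (S.coeff n 1 b) q - pd b (S.coeff n 1 a) q =
      S.coeff n 0 a q * S.coeff n 2 b q - S.coeff n 0 b q * S.coeff n 2 a q := by
  rw [S.pd_coeff_sub hq, H.structure_two n a b _ (S.jet_mem n q hq)]
  rfl

theorem coeff_structure_three {q : Space n} (hq : q ∈ S.V n) (a b : Fin (n + 2)) :
    pd a (S.coeff n 2 b) q - pd b (S.coeff n 2 a) q =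
      S.coeff n 0 a q * S.coeff n 1 b q - S.coeff n 0 b q * S.coeff n 1 a q := by
  rw [S.pd_coeff_sub hq, H.structure_three n a b _ (S.jet_mem n q hq)]
  rfl

/-- The x-direction is tangent to the hyperplane τₙ₊₁ = 0, so restriction to it commutes with all
x-derivatives. -/
theorem jet_incl {q : Space n} (hq : q ∈ S.V n) :
    jet (S.u (n + 1)) (incl q) = jet (S.u n) q := by
  refine Prod.ext (extend_incl q) (funext fun j => ?_)
  change ((pd 0)^[j] (S.u (n + 1))) (incl q) = ((pd 0)^[j] (S.u n)) q
  have h : ∀ j, ∀ q ∈ S.V n, ((pd 0)^[j] (S.u (n + 1))) (incl q) = ((pd 0)^[j] (S.u n)) q := by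
    intro j
    induction j with
    | zero => exact S.restrict n
    | succ j ih =>
      intro q hq
      rw [Function.iterate_succ_apply', Function.iterate_succ_apply']
      have h1 : HasFDerivAt ((pd 0)^[j] (S.u (n + 1)))
          (fderiv ℝ ((pd 0)^[j] (S.u (n + 1))) (incl q)) (inclL n q) := by
        rw [inclL_apply]
        exact (((contDiffOn_pd_iterate (S.isOpen_V _) (S.smooth _) 0 j).contDiffAt
          ((S.isOpen_V _).mem_nhds (S.incl_mem n q hq))).differentiableAt (by simp)).hasFDerivAt
      have h2 := h1.comp q (inclL n).hasFDerivAt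
      have h3 : HasFDerivAt ((pd 0)^[j] (S.u n)) _ q := h2.congr_of_eventuallyEq
        (Filter.eventually_of_mem ((S.isOpen_V n).mem_nhds hq) fun r hr => by
          rw [Function.comp_apply, inclL_apply, ih r hr])
      rw [pd, pd, h3.fderiv, ContinuousLinearMap.comp_apply, inclL_apply, incl_single]
      rfl
  exact h j q hq

theorem coeff_incl {q : Space n} (hq : q ∈ S.V n) (α : Fin 3) (k : Fin (n + 2)) :
    S.coeff (n + 1) α k.castSucc (incl q) = S.coeff n α k q := by
  rw [coeff, coeff, S.jet_incl hq]
  rfl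

end Solution

end Hierarchy

/-! ### The flat connection of the moving frames -/

section Generators

/-- The infinitesimal generators of the Lorentz group that act on the rows
`(r_i, e₁_i, e₂_i)` of a moving frame of the hyperbolic plane. -/
noncomputable def generator : Fin 3 → (Fin 3 → ℝ) →L[ℝ] (Fin 3 → ℝ) :=
  ![ContinuousLinearMap.pi ![ContinuousLinearMap.proj 1, ContinuousLinearMap.proj 0, 0],
    ContinuousLinearMap.pi ![ContinuousLinearMap.proj 2, 0, ContinuousLinearMap.proj 0],
    ContinuousLinearMap.pi ![0, ContinuousLinearMap.proj 2, -ContinuousLinearMap.proj 1]]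

theorem generator_zero (y : Fin 3 → ℝ) : generator 0 y = ![y 1, y 0, 0] := by
  ext i; fin_cases i <;> simp [generator]

theorem generator_one (y : Fin 3 → ℝ) : generator 1 y = ![y 2, 0, y 0] := by
  ext i; fin_cases i <;> simp [generator]

theorem generator_two (y : Fin 3 → ℝ) : generator 2 y = ![0, y 2, -y 1] := by
  ext i; fin_cases i <;> simp [generator]

end Generators

section Forms

variable {n : ℕ}

theorem fderiv_apply_eq_sum_pd (g : Space n → ℝ) (q v : Space n) :
    fderiv ℝ g q v = ∑ a, v a * pd a g q := by
  refine (LinearMap.pi_apply_eq_sum_univ (fderiv ℝ g q).toLinearMap v).trans ?_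
  refine Finset.sum_congr rfl fun a _ => ?_
  rw [smul_eq_mul, pd, ContinuousLinearMap.coe_coe]
  congr 2
  ext k
  simp [Pi.single_apply, eq_comm]

/-- The exterior derivative of a one-form whose coefficients satisfy a structure equation. -/
theorem sum_fderiv_sub_sum_fderiv {g : Fin (n + 2) → Space n → ℝ} {q : Space n}
    {P Q : Fin (n + 2) → ℝ}
    (h : ∀ a b, pd a (g b) q - pd b (g a) q = P a * Q b - P b * Q a) (v w : Space n) :
    ∑ k, fderiv ℝ (g k) q v * w k - ∑ k, fderiv ℝ (g k) q w * v k =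
      (∑ k, P k * v k) * (∑ k, Q k * w k) - (∑ k, P k * w k) * (∑ k, Q k * v k) := by
  have e1 : ∑ k, fderiv ℝ (g k) q v * w k = ∑ a, ∑ b, pd a (g b) q * (v a * w b) := by
    rw [Finset.sum_comm]
    refine Finset.sum_congr rfl fun k _ => ?_
    rw [fderiv_apply_eq_sum_pd, Finset.sum_mul]
    exact Finset.sum_congr rfl fun a _ => by ring
  have e2 : ∑ k, fderiv ℝ (g k) q w * v k = ∑ a, ∑ b, pd b (g a) q * (v a * w b) := by
    refine Finset.sum_congr rfl fun k _ => ?_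
    rw [fderiv_apply_eq_sum_pd, Finset.sum_mul]
    exact Finset.sum_congr rfl fun a _ => by ring
  rw [e1, e2, ← Finset.sum_sub_distrib, Finset.sum_mul_sum, Finset.sum_mul_sum,
    Finset.sum_comm (f := fun i j => P i * w i * (Q j * v j)), ← Finset.sum_sub_distrib]
  refine Finset.sum_congr rfl fun a _ => ?_
  rw [← Finset.sum_sub_distrib, ← Finset.sum_sub_distrib]
  refine Finset.sum_congr rfl fun b _ => ?_
  rw [← sub_mul, h]
  ring

end Forms

namespace Hierarchy.Solution

variable {H : Hierarchy} (S : H.Solution) {n : ℕ}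

theorem Θ_apply (α : Fin 3) (q v : Space n) : S.Θ n α q v = ∑ k, S.coeff n α k q * v k := by
  simp [Θ]

theorem contDiffOn_Θ (α : Fin 3) : ContDiffOn ℝ ∞ (S.Θ n α) (S.V n) := by
  unfold Θ
  exact ContDiffOn.sum fun k _ => (S.contDiffOn_coeff α k).smul contDiffOn_const

theorem Θ_incl {q : Space n} (hq : q ∈ S.V n) (α : Fin 3) (v : Space n) :
    S.Θ (n + 1) α (incl q) (incl v) = S.Θ n α q v := by
  rw [Θ_apply, Θ_apply, Fin.sum_univ_castSucc]
  have h1 : incl v (Fin.last (n + 2)) = 0 := by simp [incl, extend]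
  have h2 : ∀ k : Fin (n + 2), incl v k.castSucc = v k := fun k => by simp [incl, extend]
  simp only [h1, h2, S.coeff_incl hq, mul_zero, add_zero]

theorem fderiv_Θ_apply {q : Space n} (hq : q ∈ S.V n) (α : Fin 3) (v w : Space n) :
    fderiv ℝ (S.Θ n α) q v w = ∑ k, fderiv ℝ (S.coeff n α k) q v * w k := by
  have h1 : HasFDerivAt (S.Θ n α) (∑ k, (fderiv ℝ (S.coeff n α k) q).smulRight
      (ContinuousLinearMap.proj k : Space n →L[ℝ] ℝ)) q := by
    unfold Θ
    exact HasFDerivAt.fun_sum fun k _ => HasFDerivAt.smul_const (F := Space n →L[ℝ] ℝ)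
      (((S.contDiffOn_coeff α k).contDiffAt ((S.isOpen_V n).mem_nhds hq)).differentiableAt
        (by simp)).hasFDerivAt (ContinuousLinearMap.proj k : Space n →L[ℝ] ℝ)
  rw [h1.fderiv]
  simp

theorem Θ_structure_one {q : Space n} (hq : q ∈ S.V n) (v w : Space n) :
    fderiv ℝ (S.Θ n 0) q v w - fderiv ℝ (S.Θ n 0) q w v =
      S.Θ n 2 q v * S.Θ n 1 q w - S.Θ n 2 q w * S.Θ n 1 q v := by
  rw [S.fderiv_Θ_apply hq, S.fderiv_Θ_apply hq]
  simp only [Θ_apply]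
  exact sum_fderiv_sub_sum_fderiv (S.coeff_structure_one hq) v w

theorem Θ_structure_two {q : Space n} (hq : q ∈ S.V n) (v w : Space n) :
    fderiv ℝ (S.Θ n 1) q v w - fderiv ℝ (S.Θ n 1) q w v =
      S.Θ n 0 q v * S.Θ n 2 q w - S.Θ n 0 q w * S.Θ n 2 q v := by
  rw [S.fderiv_Θ_apply hq, S.fderiv_Θ_apply hq]
  simp only [Θ_apply]
  exact sum_fderiv_sub_sum_fderiv (S.coeff_structure_two hq) v w

theorem Θ_structure_three {q : Space n} (hq : q ∈ S.V n) (v w : Space n) :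
    fderiv ℝ (S.Θ n 2) q v w - fderiv ℝ (S.Θ n 2) q w v =
      S.Θ n 0 q v * S.Θ n 1 q w - S.Θ n 0 q w * S.Θ n 1 q v := by
  rw [S.fderiv_Θ_apply hq, S.fderiv_Θ_apply hq]
  simp only [Θ_apply]
  exact sum_fderiv_sub_sum_fderiv (S.coeff_structure_three hq) v w

/-- The coefficient of the linear system `dr = Θ₁ e₁ + Θ₂ e₂`, `de₁ = Θ₁ r + Θ₃ e₂`,
`de₂ = Θ₂ r - Θ₃ e₁` of the moving frames. -/
noncomputable def connection (n : ℕ) (q : Space n) :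
    Space n →L[ℝ] (Fin 3 → ℝ) →L[ℝ] (Fin 3 → ℝ) :=
  ∑ α, (S.Θ n α q).smulRight (generator α)

theorem connection_apply (q v : Space n) :
    S.connection n q v = ∑ α, S.Θ n α q v • generator α := by
  simp [connection]

theorem connection_incl {q : Space n} (hq : q ∈ S.V n) (v : Space n) :
    S.connection (n + 1) (incl q) (incl v) = S.connection n q v := by
  simp only [connection_apply, S.Θ_incl hq]

theorem contDiffOn_connection : ContDiffOn ℝ ∞ (S.connection n) (S.V n) := by
  unfold connection
  refine ContDiffOn.sum fun α _ => ?_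
  have h : ContDiff ℝ ∞ fun T : Space n →L[ℝ] ℝ => T.smulRight (generator α) :=
    IsBoundedLinearMap.contDiff
      ⟨⟨fun _ _ => by ext; simp [add_mul], fun _ _ => by ext; simp [mul_assoc]⟩,
        ‖generator α‖ + 1, by positivity, fun T => by
          rw [ContinuousLinearMap.norm_smulRight_apply]
          nlinarith [norm_nonneg T]⟩
  exact h.comp_contDiffOn (S.contDiffOn_Θ α)

theorem fderiv_connection_apply {q : Space n} (hq : q ∈ S.V n) (v w : Space n) (y : Fin 3 → ℝ) :
    fderiv ℝ (S.connection n) q v w y = ∑ α, fderiv ℝ (S.Θ n α) q v w • generator α y := by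
  have hd : DifferentiableAt ℝ (S.connection n) q :=
    (S.contDiffOn_connection.contDiffAt ((S.isOpen_V n).mem_nhds hq)).differentiableAt (by simp)
  have h1 : HasFDerivAt (fun q => S.connection n q w y)
      (((fderiv ℝ (S.connection n) q).flip w).flip y) q := by
    have h2 : HasFDerivAt (fun q => S.connection n q w)
        ((fderiv ℝ (S.connection n) q).flip w) q := by
      refine (hd.hasFDerivAt.clm_apply (hasFDerivAt_const w q)).congr_fderiv ?_
      ext; simp
    refine (h2.clm_apply (hasFDerivAt_const y q)).congr_fderiv ?_
    ext; simp
  have h3 : HasFDerivAt (fun q => S.connection n q w y)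
      (∑ α, ((fderiv ℝ (S.Θ n α) q).flip w).smulRight (generator α y)) q := by
    have h4 : (fun q => S.connection n q w y) =
        fun q => ∑ α, S.Θ n α q w • generator α y := by
      ext1 r
      rw [connection_apply]
      simp
    rw [h4]
    refine HasFDerivAt.fun_sum fun α _ => HasFDerivAt.smul_const ?_ _
    have hdΘ : DifferentiableAt ℝ (S.Θ n α) q :=
      ((S.contDiffOn_Θ α).contDiffAt ((S.isOpen_V n).mem_nhds hq)).differentiableAt (by simp)
    refine (hdΘ.hasFDerivAt.clm_apply (hasFDerivAt_const w q)).congr_fderiv ?_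
    ext; simp
  have h5 := congrArg (fun T => T v) (h1.unique h3)
  simpa using h5

/-- The structure equations say that the connection is flat. -/
theorem connection_flat {q : Space n} (hq : q ∈ S.V n) (v w : Space n) :
    fderiv ℝ (S.connection n) q v w + (S.connection n q w).comp (S.connection n q v) =
      fderiv ℝ (S.connection n) q w v + (S.connection n q v).comp (S.connection n q w) := by
  ext1 y
  have h1 := S.Θ_structure_one hq v w
  have h2 := S.Θ_structure_two hq v w
  have h3 := S.Θ_structure_three hq v w
  simp only [_root_.add_apply, ContinuousLinearMap.comp_apply,
    S.fderiv_connection_apply hq, connection_apply, Fin.sum_univ_three, _root_.smul_apply,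
    generator_zero, generator_one, generator_two]
  -- The commutators of the generators have the signs of the three structure equations, so each row
  -- is a combination of two of these.
  ext i
  fin_cases i
  · simp
    linear_combination y 1 * h1 + y 2 * h2
  · simp
    linear_combination y 0 * h1 + y 2 * h3
  · simp
    linear_combination y 0 * h2 - y 1 * h3

end Hierarchy.Solution

theorem abs_add_mul_sub_lt {x y r s : ℝ} (hx : |x| < r) (hy : |y| < r)
    (hs : s ∈ Icc (0 : ℝ) 1) : |x + s * (y - x)| < r := by
  have h := (convex_ball (0 : ℝ) r).add_smul_sub_mem (x := x) (y := y) (by simpa using hx)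
    (by simpa using hy) hs
  simpa using h

/-! ### Domains of the moving frames -/

section Slide

variable {n : ℕ}

/-- The point with `(x, t) = (y₁, y₂)` whose other variables are those of `q` scaled by `y₃`. -/
def slide (y : ℝ × ℝ × ℝ) (q : Space n) : Space n :=
  fun k => if (k : ℕ) = 0 then y.1 else if (k : ℕ) = 1 then y.2.1 else y.2.2 * q k

/-- The vector with `(x, t) = 0` whose other components are those of `q`. -/
def times (q : Space n) : Space n := fun k => if (k : ℕ) < 2 then 0 else q k

/-- The point `c` of the `(x, t)`-plane in the space of the first `n + 2` variables. -/
def centre (c : Space 0) (n : ℕ) : Space n := fun k => extend c k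

theorem incl_castSucc (q : Space n) (k : Fin (n + 2)) : incl q k.castSucc = q k := by
  simp [incl, extend]

theorem incl_last (q : Space n) : incl q (Fin.last (n + 2)) = 0 := by
  simp [incl, extend]

theorem incl_zero_apply (q : Space n) : incl q 0 = q 0 := by simp [incl, extend]

theorem incl_one_apply (q : Space n) : incl q 1 = q 1 := by
  have := incl_castSucc q 1
  rwa [Fin.castSucc_one] at this

theorem incl_slide (y : ℝ × ℝ × ℝ) (q : Space n) : incl (slide y q) = slide y (incl q) := by
  ext k
  induction k using Fin.lastCases with
  | last => simp [incl_last, slide]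
  | cast k => simp [incl_castSucc, slide]

theorem incl_times (q : Space n) : incl (times q) = times (incl q) := by
  ext k
  induction k using Fin.lastCases with
  | last => simp [incl_last, times]
  | cast k => simp [incl_castSucc, times]

theorem incl_centre (c : Space 0) (n : ℕ) : incl (centre c n) = centre c (n + 1) := by
  ext k
  induction k using Fin.lastCases with
  | last => simp [incl_last, centre, extend]
  | cast k => simp [incl_castSucc, centre]

theorem centre_zero (c : Space 0) : centre c 0 = c := by
  ext k
  exact extend_of_lt c k.2

theorem centre_apply_zero (c : Space 0) (n : ℕ) : centre c n 0 = c 0 := by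
  simp [centre, extend]

theorem centre_apply_one (c : Space 0) (n : ℕ) : centre c n 1 = c 1 := by
  simp [centre, extend]

theorem centre_succ_succ (c : Space 0) (n : ℕ) (j : Fin n) : centre c n j.succ.succ = 0 := by
  simp [centre, extend]

theorem space_ext {p q : Space n} (h0 : p 0 = q 0) (h1 : p 1 = q 1)
    (h2 : ∀ j : Fin n, p j.succ.succ = q j.succ.succ) : p = q := by
  ext k
  induction k using Fin.cases with
  | zero => exact h0
  | succ k =>
    induction k using Fin.cases with
    | zero => exact h1
    | succ j => exact h2 j

theorem slide_zero (y : ℝ × ℝ × ℝ) (q : Space n) : slide y q 0 = y.1 := by simp [slide]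

theorem slide_one (y : ℝ × ℝ × ℝ) (q : Space n) : slide y q 1 = y.2.1 := by simp [slide]

theorem slide_succ_succ (y : ℝ × ℝ × ℝ) (q : Space n) (j : Fin n) :
    slide y q j.succ.succ = y.2.2 * q j.succ.succ := by simp [slide]

theorem times_zero_apply (q : Space n) : times q 0 = 0 := by simp [times]

theorem times_one_apply (q : Space n) : times q 1 = 0 := by simp [times]

theorem times_succ_succ (q : Space n) (j : Fin n) : times q j.succ.succ = q j.succ.succ := by
  simp [times]

theorem single_zero_succ_succ (i : Fin n) :
    (Pi.single 0 1 : Space n) i.succ.succ = 0 := by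
  simp

theorem single_one_succ_succ (i : Fin n) :
    (Pi.single 1 1 : Space n) i.succ.succ = 0 := by
  rw [Pi.single_apply, if_neg]
  rw [← Fin.succ_zero_eq_one]
  exact fun h => Fin.succ_ne_zero i (Fin.succ_injective _ h)

theorem incl_single_zero : incl (Pi.single 0 1 : Space n) = Pi.single 0 1 := by
  rw [incl_single, Fin.castSucc_zero]

theorem incl_single_one : incl (Pi.single 1 1 : Space n) = Pi.single 1 1 := by
  rw [incl_single, Fin.castSucc_one]

theorem continuous_slide :
    Continuous fun z : Space n × (ℝ × ℝ × ℝ) => slide z.2 z.1 := by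
  refine continuous_pi fun k => ?_
  unfold slide
  split_ifs <;> fun_prop

theorem continuous_times : Continuous fun q : Space n => times q := by
  refine continuous_pi fun k => ?_
  unfold times
  split_ifs <;> fun_prop

end Slide

namespace Hierarchy.Solution

variable {H : Hierarchy} (S : H.Solution) {n : ℕ}

/-- The points where the `(x, t)`-components of the forms are close to those at `c` and those of
the connection are bounded by `a`. -/
def near (c : Space 0) (η a : ℝ) (n : ℕ) : Set (Space n) :=
  {m | m ∈ S.V n ∧ (∀ α, |S.coeff n α 0 m - S.coeff 0 α 0 c| < η ∧
    |S.coeff n α 1 m - S.coeff 0 α 1 c| < η) ∧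
    ‖S.connection n m (Pi.single 0 1)‖ < a ∧ ‖S.connection n m (Pi.single 1 1)‖ < a}

/-- The values of `(x, t)` and of the scaling factor of the other variables. -/
def cube (c : Space 0) (ρ : ℝ) : Set (ℝ × ℝ × ℝ) :=
  Icc (c 0 - ρ) (c 0 + ρ) ×ˢ Icc (c 1 - ρ) (c 1 + ρ) ×ˢ Icc 0 1

/-- The domain of a moving frame. -/
def frameDomain (c : Space 0) (η a ρ : ℝ) (n : ℕ) : Set (Space n) :=
  {q | |q 0 - c 0| < ρ ∧ |q 1 - c 1| < ρ ∧ ∀ y ∈ cube c ρ,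
    slide y q ∈ S.near c η a n ∧ ‖S.connection n (slide y q) (times q)‖ < 1 / 32}

variable {S} {c : Space 0} {η a ρ : ℝ}

theorem isOpen_near : IsOpen (S.near c η a n) := by
  rw [isOpen_iff_mem_nhds]
  rintro m ⟨hm, h1, h2, h3⟩
  have hV := (S.isOpen_V n).mem_nhds hm
  have hcoeff : ∀ α k, ContinuousAt (S.coeff n α k) m := fun α k =>
    (S.contDiffOn_coeff α k).continuousOn.continuousAt hV
  have hconn : ContinuousAt (S.connection n) m :=
    S.contDiffOn_connection.continuousOn.continuousAt hV
  have hconn' : ∀ v, ContinuousAt (fun m => ‖S.connection n m v‖) m := fun v =>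
    ContinuousAt.norm (E := (Fin 3 → ℝ) →L[ℝ] (Fin 3 → ℝ)) (hconn.clm_apply continuousAt_const)
  have e1 : ∀ᶠ p in 𝓝 m, ∀ α, |S.coeff n α 0 p - S.coeff 0 α 0 c| < η ∧
      |S.coeff n α 1 p - S.coeff 0 α 1 c| < η := by
    rw [eventually_all]
    intro α
    exact (((hcoeff α 0).sub continuousAt_const).abs.eventually (gt_mem_nhds (h1 α).1)).and
      (((hcoeff α 1).sub continuousAt_const).abs.eventually (gt_mem_nhds (h1 α).2))
  filter_upwards [hV, e1, (hconn' _).eventually (gt_mem_nhds h2),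
    (hconn' _).eventually (gt_mem_nhds h3)] with p p0 p1 p2 p3
  exact ⟨p0, p1, p2, p3⟩

theorem incl_mem_near {m : Space n} (hm : m ∈ S.near c η a n) :
    incl m ∈ S.near c η a (n + 1) := by
  obtain ⟨h0, h1, h2, h3⟩ := hm
  refine ⟨S.incl_mem n m h0, fun α => ⟨?_, ?_⟩, ?_, ?_⟩
  · have := S.coeff_incl h0 α 0
    rw [Fin.castSucc_zero] at this
    rw [this]
    exact (h1 α).1
  · have := S.coeff_incl h0 α 1
    rw [Fin.castSucc_one] at this
    rw [this]
    exact (h1 α).2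
  · rw [← incl_single_zero, S.connection_incl h0]
    exact h2
  · rw [← incl_single_one, S.connection_incl h0]
    exact h3

theorem isCompact_cube : IsCompact (cube c ρ) :=
  isCompact_Icc.prod (isCompact_Icc.prod isCompact_Icc)

/-- Tube lemma: strict inequalities that hold for all `y` in the compact `cube` persist for nearby
`q`. This is why the definition tests a closed square and a closed interval of scalings. -/
theorem isOpen_frameDomain : IsOpen (S.frameDomain c η a ρ n) := by
  have h0 : IsOpen {q : Space n | |q 0 - c 0| < ρ} :=
    isOpen_lt (by fun_prop) continuous_const
  have h1 : IsOpen {q : Space n | |q 1 - c 1| < ρ} :=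
    isOpen_lt (by fun_prop) continuous_const
  refine h0.inter (h1.inter (isOpen_iff_mem_nhds.2 ?_))
  intro q hq
  refine isCompact_cube.eventually_forall_of_forall_eventually
    (P := fun (q : Space n) y => slide y q ∈ S.near c η a n ∧
      ‖S.connection n (slide y q) (times q)‖ < 1 / 32) fun y hy => ?_
  obtain ⟨hn, hlt⟩ := hq y hy
  have hs : ContinuousAt (fun z : Space n × (ℝ × ℝ × ℝ) => slide z.2 z.1) (q, y) :=
    continuous_slide.continuousAt
  have hconn : ContinuousAt
      (fun z : Space n × (ℝ × ℝ × ℝ) => S.connection n (slide z.2 z.1)) (q, y) :=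
    ContinuousAt.comp_of_eq (f := fun z : Space n × (ℝ × ℝ × ℝ) => slide z.2 z.1)
      (S.contDiffOn_connection.continuousOn.continuousAt ((S.isOpen_V n).mem_nhds hn.1)) hs rfl
  have ht : ContinuousAt (fun z : Space n × (ℝ × ℝ × ℝ) => times z.1) (q, y) :=
    (continuous_times.comp continuous_fst).continuousAt
  have hnorm : ContinuousAt (fun z : Space n × (ℝ × ℝ × ℝ) =>
      ‖S.connection n (slide z.2 z.1) (times z.1)‖) (q, y) :=
    ContinuousAt.norm (E := (Fin 3 → ℝ) →L[ℝ] (Fin 3 → ℝ)) (hconn.clm_apply ht)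
  exact (hs.eventually (isOpen_near.mem_nhds hn)).and (hnorm.eventually (gt_mem_nhds hlt))

theorem incl_mem_frameDomain {q : Space n} (hq : q ∈ S.frameDomain c η a ρ n) :
    incl q ∈ S.frameDomain c η a ρ (n + 1) := by
  obtain ⟨h0, h1, h2⟩ := hq
  refine ⟨by rwa [incl_zero_apply], by rwa [incl_one_apply], fun y hy => ?_⟩
  obtain ⟨h3, h4⟩ := h2 y hy
  rw [← incl_slide, ← incl_times, S.connection_incl h3.1]
  exact ⟨incl_mem_near h3, h4⟩

theorem near_of_mem_frameDomain {q : Space n} (hq : q ∈ S.frameDomain c η a ρ n) :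
    q ∈ S.near c η a n := by
  obtain ⟨h0, h1, h2⟩ := hq
  rw [abs_lt] at h0 h1
  have h3 := (h2 (q 0, q 1, 1) ⟨⟨by linarith, by linarith⟩, ⟨by linarith, by linarith⟩,
    by simp, by simp⟩).1
  have h4 : slide (q 0, q 1, 1) q = q :=
    space_ext (slide_zero _ _) (slide_one _ _) fun j => by rw [slide_succ_succ, one_mul]
  rwa [h4] at h3

theorem frameDomain_subset : S.frameDomain c η a ρ n ⊆ S.V n :=
  fun _ hq => (near_of_mem_frameDomain hq).1

/-- The condition on τ does not involve (x, t) and is inherited by b τ for b in [0, 1], since a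
scaling of a scaling is again tested by `cube`. Star convexity about the centre and convexity of the
slices of constant τ (b = 1) both follow. -/
theorem mem_frameDomain_of_scaled {p q : Space n} (hq : q ∈ S.frameDomain c η a ρ n) {b : ℝ}
    (hb : b ∈ Icc (0 : ℝ) 1) (h0 : |p 0 - c 0| < ρ) (h1 : |p 1 - c 1| < ρ)
    (h2 : ∀ j : Fin n, p j.succ.succ = b * q j.succ.succ) : p ∈ S.frameDomain c η a ρ n := by
  refine ⟨h0, h1, fun y hy => ?_⟩
  have e1 : slide y p = slide (y.1, y.2.1, y.2.2 * b) q :=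
    space_ext (by simp [slide_zero]) (by simp [slide_one]) fun j => by
      rw [slide_succ_succ, slide_succ_succ, h2, mul_assoc]
  have e2 : times p = b • times q :=
    space_ext (by simp [times_zero_apply]) (by simp [times_one_apply]) fun j => by
      rw [times_succ_succ, Pi.smul_apply, times_succ_succ, h2, smul_eq_mul]
  obtain ⟨h3, h4⟩ := hq.2.2 (y.1, y.2.1, y.2.2 * b) ⟨hy.1, hy.2.1,
    mul_nonneg hy.2.2.1 hb.1, mul_le_one₀ hy.2.2.2 hb.1 hb.2⟩
  rw [e1, e2, map_smul, norm_smul, Real.norm_of_nonneg hb.1]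
  exact ⟨h3, (mul_le_of_le_one_left (norm_nonneg _) hb.2).trans_lt h4⟩

theorem starConvex_frameDomain :
    StarConvex ℝ (centre c n) (S.frameDomain c η a ρ n) := by
  intro q hq s b hs hb hsb
  refine mem_frameDomain_of_scaled hq ⟨hb, by linarith⟩ ?_ ?_ fun j => ?_
  · have : (s • centre c n + b • q) 0 - c 0 = b * (q 0 - c 0) := by
      obtain rfl : s = 1 - b := by linarith
      simp [centre_apply_zero]; ring
    rw [this, abs_mul, abs_of_nonneg hb]
    exact (mul_le_of_le_one_left (abs_nonneg _) (by linarith)).trans_lt hq.1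
  · have : (s • centre c n + b • q) 1 - c 1 = b * (q 1 - c 1) := by
      obtain rfl : s = 1 - b := by linarith
      simp [centre_apply_one]; ring
    rw [this, abs_mul, abs_of_nonneg hb]
    exact (mul_le_of_le_one_left (abs_nonneg _) (by linarith)).trans_lt hq.2.1
  · simp [centre_succ_succ]

theorem segment_mem_frameDomain {p q : Space n} (hp : p ∈ S.frameDomain c η a ρ n)
    (hq : q ∈ S.frameDomain c η a ρ n) (hpq : ∀ j : Fin n, p j.succ.succ = q j.succ.succ) {s : ℝ}
    (hs : s ∈ Icc (0 : ℝ) 1) : p + s • (q - p) ∈ S.frameDomain c η a ρ n := by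
  refine mem_frameDomain_of_scaled hp (b := 1) (by simp) ?_ ?_ fun j => ?_
  · have := abs_add_mul_sub_lt hp.1 hq.1 hs
    rwa [sub_sub_sub_cancel_right, sub_add_eq_add_sub] at this
  · have := abs_add_mul_sub_lt hp.2.1 hq.2.1 hs
    rwa [sub_sub_sub_cancel_right, sub_add_eq_add_sub] at this
  · simp [hpq]

/-- The x- and t-parts of the displacement contribute at most ρa ≤ 1/64 each and the τ-part at most
1/32. The bound 1/16 is doubled in `exists_flat_system_solution`, which leaves the frame within 1/8
of the identity. -/
theorem connection_ray_le (hρ : 0 < ρ) (ha : ρ * a ≤ 1 / 64) {q : Space n}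
    (hq : q ∈ S.frameDomain c η a ρ n) {s : ℝ} (hs : s ∈ Icc (0 : ℝ) 1) :
    ‖S.connection n (centre c n + s • (q - centre c n)) (q - centre c n)‖ ≤ 1 / 16 := by
  obtain ⟨h0, h1, h2⟩ := hq
  have e1 : centre c n + s • (q - centre c n) =
      slide (c 0 + s * (q 0 - c 0), c 1 + s * (q 1 - c 1), s) q :=
    space_ext (by simp [slide_zero, centre_apply_zero]) (by simp [slide_one, centre_apply_one])
      fun j => by simp [slide_succ_succ, centre_succ_succ]
  have e2 : q - centre c n = (q 0 - c 0) • Pi.single 0 1 + (q 1 - c 1) • Pi.single 1 1 +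
      times q :=
    space_ext (by simp [times_zero_apply, centre_apply_zero])
      (by simp [times_one_apply, centre_apply_one])
      fun j => by
        simp only [Pi.sub_apply, Pi.add_apply, Pi.smul_apply, single_zero_succ_succ,
          single_one_succ_succ, times_succ_succ, centre_succ_succ]
        simp
  have hb : ∀ x : ℝ, |x| < ρ → |s * x| ≤ ρ := fun x hx => by
    rw [abs_mul, abs_of_nonneg hs.1]
    exact (mul_le_of_le_one_left (abs_nonneg _) hs.2).trans hx.le
  obtain ⟨⟨-, -, h3, h4⟩, h5⟩ := h2 (c 0 + s * (q 0 - c 0), c 1 + s * (q 1 - c 1), s) (by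
    have b0 := abs_le.1 (hb _ h0)
    have b1 := abs_le.1 (hb _ h1)
    exact ⟨⟨by linarith [b0.1], by linarith [b0.2]⟩, ⟨by linarith [b1.1], by linarith [b1.2]⟩, hs⟩)
  rw [e1, e2, map_add, map_add, map_smul, map_smul]
  refine (norm_add_le _ _).trans ?_
  have h6 : ∀ (x : ℝ) (T : (Fin 3 → ℝ) →L[ℝ] (Fin 3 → ℝ)), |x| < ρ → ‖T‖ < a →
      ‖x • T‖ ≤ 1 / 64 := fun x T hx hT => by
    rw [norm_smul, Real.norm_eq_abs]
    exact (mul_le_mul hx.le hT.le (norm_nonneg _) hρ.le).trans ha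
  have h7 := norm_add_le
    ((q 0 - c 0) • S.connection n
      (slide (c 0 + s * (q 0 - c 0), c 1 + s * (q 1 - c 1), s) q) (Pi.single 0 1))
    ((q 1 - c 1) • S.connection n
      (slide (c 0 + s * (q 0 - c 0), c 1 + s * (q 1 - c 1), s) q) (Pi.single 1 1))
  linarith [h6 _ _ h0 h3, h6 _ _ h1 h4]

theorem centre_mem_frameDomain (hρ : 0 < ρ)
    (h : ∀ z : Space 0, |z 0 - c 0| ≤ ρ → |z 1 - c 1| ≤ ρ → z ∈ S.near c η a 0) (n : ℕ) :
    centre c n ∈ S.frameDomain c η a ρ n := by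
  induction n with
  | zero =>
    rw [centre_zero]
    refine ⟨by simpa using hρ, by simpa using hρ, fun y hy => ⟨h _ ?_ ?_, ?_⟩⟩
    · rw [slide_zero, abs_le]
      constructor <;> linarith [hy.1.1, hy.1.2]
    · rw [slide_one, abs_le]
      constructor <;> linarith [hy.2.1.1, hy.2.1.2]
    · have : times c = 0 := space_ext (times_zero_apply c) (times_one_apply c) fun j => j.elim0
      rw [this]
      simp
  | succ n ih =>
    rw [← incl_centre]
    exact incl_mem_frameDomain ih

end Hierarchy.Solution

/-! ### Estimates near the base point -/

section Estimates

/-- Used for the matrix of the x- and t-coefficients of Θ₁, Θ₂ at the base point, invertible by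
III-genericity. A change of these coefficients by less than η alters each Θ(w) by at most 1/64 of
|Θ₁(w)| + |Θ₂(w)|. The bound comes from solving for x and y by Cramer's rule. -/
theorem exists_pos_mul_abs_add_abs_le {a b c d : ℝ} (h : a * d - b * c ≠ 0) :
    ∃ η : ℝ, 0 < η ∧ ∀ x y : ℝ,
      64 * (η * (|x| + |y|)) ≤ |a * x + b * y| + |c * x + d * y| := by
  set M := |a| + |b| + |c| + |d| + 1 with hM
  have hM0 : 0 < M := by positivity
  have hD : 0 < |a * d - b * c| := abs_pos.2 h
  refine ⟨|a * d - b * c| / (64 * M), by positivity, fun x y => ?_⟩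
  set u := a * x + b * y
  set v := c * x + d * y
  have e1 : |a * d - b * c| * |x| ≤ |d| * |u| + |b| * |v| := by
    rw [← abs_mul, show (a * d - b * c) * x = d * u - b * v by ring]
    exact (abs_sub _ _).trans_eq (by rw [abs_mul, abs_mul])
  have e2 : |a * d - b * c| * |y| ≤ |a| * |v| + |c| * |u| := by
    rw [← abs_mul, show (a * d - b * c) * y = a * v - c * u by ring]
    exact (abs_sub _ _).trans_eq (by rw [abs_mul, abs_mul])
  have e3 : 64 * (|a * d - b * c| / (64 * M) * (|x| + |y|)) =
      (|a * d - b * c| * |x| + |a * d - b * c| * |y|) / M := by field_simp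
  rw [e3, div_le_iff₀ hM0]
  nlinarith [mul_nonneg (abs_nonneg a) (abs_nonneg u), mul_nonneg (abs_nonneg b) (abs_nonneg u),
    mul_nonneg (abs_nonneg c) (abs_nonneg v), mul_nonneg (abs_nonneg d) (abs_nonneg v),
    abs_nonneg u, abs_nonneg v]

/-- Here (a, b) and (a', b') stand for (Θ₁(w), Θ₂(w)) at the base point and at a nearby point, and
the x's and y's for the tangential block of the frame, so the expression is the derivative of a r₁ +
b r₂ along w. It differs from a² + b² ≥ s²/2 by at most s²/8 + 10s²/512. -/
theorem quadratic_pos_of_near {a b a' b' x₁ x₂ y₁ y₂ : ℝ} (ha : |a' - a| ≤ (|a| + |b|) / 64)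
    (hb : |b' - b| ≤ (|a| + |b|) / 64) (hx₁ : |x₁ - 1| ≤ 1 / 8) (hx₂ : |x₂| ≤ 1 / 8)
    (hy₁ : |y₁| ≤ 1 / 8) (hy₂ : |y₂ - 1| ≤ 1 / 8) (h : 0 < |a| + |b|) :
    0 < a * (x₁ * a' + x₂ * b') + b * (y₁ * a' + y₂ * b') := by
  set s := |a| + |b| with hs
  have key : a * (x₁ * a' + x₂ * b') + b * (y₁ * a' + y₂ * b') =
      a ^ 2 + b ^ 2 + (a * a * (x₁ - 1) + a * b * x₂ + b * a * y₁ + b * b * (y₂ - 1)) +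
      (a * x₁ * (a' - a) + a * x₂ * (b' - b) + b * y₁ * (a' - a) + b * y₂ * (b' - b)) := by ring
  have hx₁' : |x₁| ≤ 9 / 8 := by
    rw [abs_le] at hx₁ ⊢; constructor <;> linarith
  have hy₂' : |y₂| ≤ 9 / 8 := by
    rw [abs_le] at hy₂ ⊢; constructor <;> linarith
  have b3 : ∀ u v w p r : ℝ, |w| ≤ p → |v| ≤ r → -(|u| * r * p) ≤ u * v * w := by
    intro u v w p r hw hv
    have : |u * v * w| ≤ |u| * r * p := by
      rw [abs_mul, abs_mul]
      have := (abs_nonneg v).trans hv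
      gcongr
    exact (abs_le.1 this).1
  have t1 := b3 a a _ _ _ hx₁ le_rfl
  have t2 := b3 a b _ _ _ hx₂ le_rfl
  have t3 := b3 b a _ _ _ hy₁ le_rfl
  have t4 := b3 b b _ _ _ hy₂ le_rfl
  have t5 := b3 a _ _ _ _ ha hx₁'
  have t6 := b3 a _ _ _ _ hb hx₂
  have t7 := b3 b _ _ _ _ ha hy₁
  have t8 := b3 b _ _ _ _ hb hy₂'
  have q1 : s ^ 2 ≤ 2 * (a ^ 2 + b ^ 2) := by
    rw [hs, ← sq_abs a, ← sq_abs b]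
    nlinarith [sq_nonneg (|a| - |b|)]
  have q2 : |a| * |a| * (1 / 8) + |a| * |b| * (1 / 8) + |b| * |a| * (1 / 8) +
      |b| * |b| * (1 / 8) = s ^ 2 / 8 := by rw [hs]; ring
  have q3 : |a| * (9 / 8) * (s / 64) + |a| * (1 / 8) * (s / 64) + |b| * (1 / 8) * (s / 64) +
      |b| * (9 / 8) * (s / 64) = s ^ 2 * (10 / 512) := by rw [hs]; ring
  rw [key]
  have : 0 < s ^ 2 := by positivity
  linarith

end Estimates

/-! ### Moving frames -/

open Hierarchy.Solution

/-- A family of orthonormal moving frames of the hyperbolic plane in Minkowski space, with the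
one-forms of a solution as its relative components. The vector number `a` of the frame has the
components `X n i q a`, `i = 0, 1, 2`; the vector number `0` is the position vector. -/
structure MovingFrame {H : Hierarchy} (S : H.Solution) where
  U : ∀ n : ℕ, Set (Space n)
  X : ∀ n : ℕ, Fin 3 → Space n → Fin 3 → ℝ
  isOpen_U : ∀ n, IsOpen (U n)
  subset : ∀ n, U n ⊆ S.V n
  incl_mem : ∀ n, ∀ q ∈ U n, incl q ∈ U (n + 1)
  c : Space 0
  c_mem : c ∈ U 0
  X_c : ∀ i, X 0 i c = Pi.single i 1
  hasFDerivAt : ∀ n i, ∀ q ∈ U n, HasFDerivAt (X n i) ((S.connection n q).flip (X n i q)) q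
  X_incl : ∀ n i, ∀ q ∈ U n, X (n + 1) i (incl q) = X n i q
  near : ∀ n i a, ∀ q ∈ U n, |X n i q a - (Pi.single i 1 : Fin 3 → ℝ) a| ≤ 1 / 8
  segment : ∀ n, ∀ p ∈ U n, ∀ q ∈ U n, (∀ j : Fin n, p j.succ.succ = q j.succ.succ) →
    ∀ s ∈ Icc (0 : ℝ) 1, p + s • (q - p) ∈ U n
  -- The pair (a, b) may depend on `w` but not on `q`: one linear function of (r₁, r₂) increases in
  -- the direction `w` on all of `U n`. This gives both immersion and global injectivity on the
  -- slices of constant τ.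
  exists_pos : ∀ n, ∀ w : Space n, (∀ j : Fin n, w j.succ.succ = 0) → w ≠ 0 → ∃ a b : ℝ,
    ∀ q ∈ U n, 0 < a * (X n 1 q 1 * S.Θ n 0 q w + X n 1 q 2 * S.Θ n 1 q w) +
      b * (X n 2 q 1 * S.Θ n 0 q w + X n 2 q 2 * S.Θ n 1 q w)
  lorentz : ∀ n, ∀ q ∈ U n, ∀ i j, -(X n i q 0 * X n j q 0) + X n i q 1 * X n j q 1 +
    X n i q 2 * X n j q 2 = if i = j then (if i = 0 then -1 else 1) else 0

section Components

variable {H : Hierarchy} {S : H.Solution} {n : ℕ} {y : Space n → Fin 3 → ℝ} {q : Space n}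

theorem hasFDerivAt_frame_zero (h : HasFDerivAt y ((S.connection n q).flip (y q)) q) :
    HasFDerivAt (fun q => y q 0) (y q 1 • S.Θ n 0 q + y q 2 • S.Θ n 1 q) q := by
  refine (hasFDerivAt_pi'.1 h 0).congr_fderiv ?_
  ext v
  simp [S.connection_apply, Fin.sum_univ_three, generator_zero, generator_one, generator_two]
  ring

theorem hasFDerivAt_frame_one (h : HasFDerivAt y ((S.connection n q).flip (y q)) q) :
    HasFDerivAt (fun q => y q 1) (y q 0 • S.Θ n 0 q + y q 2 • S.Θ n 2 q) q := by
  refine (hasFDerivAt_pi'.1 h 1).congr_fderiv ?_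
  ext v
  simp [S.connection_apply, Fin.sum_univ_three, generator_zero, generator_one, generator_two]
  ring

theorem hasFDerivAt_frame_two (h : HasFDerivAt y ((S.connection n q).flip (y q)) q) :
    HasFDerivAt (fun q => y q 2) (y q 0 • S.Θ n 1 q - y q 1 • S.Θ n 2 q) q := by
  refine (hasFDerivAt_pi'.1 h 2).congr_fderiv ?_
  ext v
  simp [S.connection_apply, Fin.sum_univ_three, generator_zero, generator_one, generator_two]
  ring

/-- The Lorentz product of two solutions of the system of the moving frames is constant. -/
theorem hasFDerivAt_lorentz {z : Space n → Fin 3 → ℝ}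
    (hy : HasFDerivAt y ((S.connection n q).flip (y q)) q)
    (hz : HasFDerivAt z ((S.connection n q).flip (z q)) q) :
    HasFDerivAt (fun q => -(y q 0 * z q 0) + y q 1 * z q 1 + y q 2 * z q 2)
      (0 : Space n →L[ℝ] ℝ) q := by
  have h := ((((hasFDerivAt_frame_zero hy).mul (hasFDerivAt_frame_zero hz)).neg.add
    ((hasFDerivAt_frame_one hy).mul (hasFDerivAt_frame_one hz))).add
    ((hasFDerivAt_frame_two hy).mul (hasFDerivAt_frame_two hz)))
  refine h.congr_fderiv ?_
  ext v
  simp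
  ring

end Components

theorem exists_movingFrame {H : Hierarchy} {S : H.Solution} (hS : S.IIIGeneric) :
    Nonempty (MovingFrame S) := by
  obtain ⟨c, hc⟩ := S.nonempty_V
  obtain ⟨η, hη, hηL⟩ := exists_pos_mul_abs_add_abs_le (hS c hc)
  set a : ℝ := 1 + ‖S.connection 0 c (Pi.single 0 1)‖ + ‖S.connection 0 c (Pi.single 1 1)‖ with ha
  have ha0 : 0 < a := by positivity
  have hcn : c ∈ S.near c η a 0 := by
    refine ⟨hc, fun α => by simpa using hη, ?_, ?_⟩ <;>
    linarith [norm_nonneg (S.connection 0 c (Pi.single 0 1)),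
      norm_nonneg (S.connection 0 c (Pi.single 1 1))]
  obtain ⟨r, hr, hball⟩ := Metric.isOpen_iff.1 (isOpen_near (S := S) (c := c)) c hcn
  -- ρ < r keeps the closed square inside `near`, and ρa ≤ 1/64 is what `connection_ray_le` needs.
  obtain ⟨ρ, hρ, hρr, hρa⟩ : ∃ ρ : ℝ, 0 < ρ ∧ ρ < r ∧ ρ * a ≤ 1 / 64 := by
    refine ⟨min (r / 2) (1 / (64 * a)), by positivity, (min_le_left _ _).trans_lt (by linarith), ?_⟩
    calc min (r / 2) (1 / (64 * a)) * a ≤ 1 / (64 * a) * a := by gcongr; exact min_le_right _ _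
      _ = 1 / 64 := by field_simp
  have hcentre := centre_mem_frameDomain (S := S) (c := c) (η := η) (a := a) hρ fun z h0 h1 => by
    refine hball ?_
    rw [Metric.mem_ball, dist_pi_lt_iff hr]
    intro k
    rw [Real.dist_eq]
    fin_cases k
    · exact h0.trans_lt hρr
    · exact h1.trans_lt hρr
  have hsol : ∀ n (i : Fin 3), ∃ y : Space n → Fin 3 → ℝ, y (centre c n) = Pi.single i 1 ∧
      ∀ q ∈ S.frameDomain c η a ρ n, HasFDerivAt y ((S.connection n q).flip (y q)) q ∧
        ‖y q - Pi.single i 1‖ ≤ 1 / 8 := by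
    intro n i
    obtain ⟨y, hy0, hy⟩ := exists_flat_system_solution isOpen_frameDomain starConvex_frameDomain
      (hcentre n) ((S.contDiffOn_connection.mono frameDomain_subset).of_le (mod_cast le_top))
      (fun q hq => S.connection_flat (frameDomain_subset hq)) (δ := 1 / 16) (by norm_num)
      (fun q hq s hs => connection_ray_le hρ hρa hq hs) (Pi.single i 1 : Fin 3 → ℝ)
    refine ⟨y, hy0, fun q hq => ⟨(hy q hq).1, (hy q hq).2.trans_eq ?_⟩⟩
    rw [Pi.norm_single]
    norm_num
  choose X hX0 hX using hsol
  have hXnear : ∀ n i a', ∀ q ∈ S.frameDomain c η a ρ n,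
      |X n i q a' - (Pi.single i 1 : Fin 3 → ℝ) a'| ≤ 1 / 8 := fun n i a' q hq =>
    (norm_le_pi_norm (X n i q - Pi.single i 1) a').trans (hX n i q hq).2
  refine ⟨{
    U := S.frameDomain c η a ρ
    X := X
    isOpen_U := fun n => isOpen_frameDomain
    subset := fun n => frameDomain_subset
    incl_mem := fun n q hq => incl_mem_frameDomain hq
    c := c
    c_mem := by simpa only [centre_zero] using hcentre 0
    X_c := fun i => by
      have := hX0 0 i
      rwa [centre_zero] at this
    hasFDerivAt := fun n i q hq => (hX n i q hq).1
    X_incl := fun n i q hq => ?_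
    near := hXnear
    segment := fun n p hp q hq hpq s hs => segment_mem_frameDomain hp hq hpq hs
    exists_pos := fun n w hw hw0 => ?_
    lorentz := fun n q hq i j => ?_ }⟩
  · have := flat_system_solution_comp (y' := X (n + 1) i) starConvex_frameDomain
      (S.contDiffOn_connection.continuousOn.mono frameDomain_subset) (inclL n)
      (fun q hq => by rw [inclL_apply]; exact incl_mem_frameDomain hq)
      (fun q hq v => by
        rw [inclL_apply, inclL_apply, S.connection_incl (frameDomain_subset hq)])
      (fun q hq => (hX n i q hq).1) (fun q hq => (hX (n + 1) i q hq).1)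
      (by rw [inclL_apply, incl_centre, hX0, hX0]) q hq
    rwa [inclL_apply] at this
  · have hΘ : ∀ α (q : Space n), S.Θ n α q w = S.coeff n α 0 q * w 0 + S.coeff n α 1 q * w 1 := by
      intro α q
      rw [S.Θ_apply, Fin.sum_univ_succ, Fin.sum_univ_succ]
      simp [hw]
    have hw01 : 0 < |w 0| + |w 1| := by
      rcases eq_or_ne (w 0) 0 with h0 | h0
      · rcases eq_or_ne (w 1) 0 with h1 | h1
        · exact absurd (space_ext h0 h1 hw) hw0
        · have := abs_pos.2 h1
          positivity
      · have := abs_pos.2 h0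
        positivity
    have hL := hηL (w 0) (w 1)
    -- The coefficients are the values of Θ₁ and Θ₂ on `w` at the base point.
    refine ⟨S.f 0 0 0 c * w 0 + S.f 0 0 1 c * w 1, S.f 0 1 0 c * w 0 + S.f 0 1 1 c * w 1,
      fun q hq => ?_⟩
    have hn := (near_of_mem_frameDomain hq).2.1
    have hd : ∀ α, |S.Θ n α q w - (S.coeff 0 α 0 c * w 0 + S.coeff 0 α 1 c * w 1)| ≤
        η * (|w 0| + |w 1|) := by
      intro α
      rw [hΘ, show S.coeff n α 0 q * w 0 + S.coeff n α 1 q * w 1 -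
        (S.coeff 0 α 0 c * w 0 + S.coeff 0 α 1 c * w 1) =
        (S.coeff n α 0 q - S.coeff 0 α 0 c) * w 0 +
          (S.coeff n α 1 q - S.coeff 0 α 1 c) * w 1 by ring]
      refine (abs_add_le _ _).trans ?_
      rw [abs_mul, abs_mul, mul_add]
      gcongr
      · exact (hn α).1.le
      · exact (hn α).2.le
    have hx := fun i a' => hXnear n i a' q hq
    refine quadratic_pos_of_near ((hd 0).trans ?_) ((hd 1).trans ?_) ?_ ?_ ?_ ?_ ?_
    · linarith
    · linarith
    · simpa using hx 1 1
    · simpa using hx 1 2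
    · simpa using hx 2 1
    · simpa using hx 2 2
    · exact lt_of_lt_of_le (by positivity) hL
  -- The Lorentz products of the rows are constant on the connected domain, and the frame is the
  -- identity at its centre.
  · have hpre : IsPreconnected (S.frameDomain c η a ρ n) :=
      (starConvex_frameDomain.isPathConnected (hcentre n)).isConnected.isPreconnected
    have hconst := isOpen_frameDomain.is_const_of_fderiv_eq_zero (𝕜 := ℝ) hpre
      (f := fun q => -(X n i q 0 * X n j q 0) + X n i q 1 * X n j q 1 + X n i q 2 * X n j q 2)
      (fun q hq => (hasFDerivAt_lorentz (hX n i q hq).1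
        (hX n j q hq).1).differentiableAt.differentiableWithinAt)
      (fun q hq => (hasFDerivAt_lorentz (hX n i q hq).1 (hX n j q hq).1).fderiv) hq (hcentre n)
    refine hconst.trans ?_
    simp only [hX0]
    fin_cases i <;> fin_cases j <;> simp

/-- An injective smooth map with injective derivatives is a chart. -/
theorem exists_smooth_chart {E : Type*} [NormedAddCommGroup E] [NormedSpace ℝ E]
    [FiniteDimensional ℝ E] {f : E → E} {U : Set E} (hU : IsOpen U) (hf : ContDiffOn ℝ ∞ f U)
    (hinj : InjOn f U) (hf' : ∀ q ∈ U, Function.Injective (fderiv ℝ f q)) :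
    ∃ e : OpenPartialHomeomorph E E, e.source = U ∧ (∀ q, e q = f q) ∧
      ContDiffOn ℝ ∞ e.symm e.target := by
  have hcomplete : CompleteSpace E := FiniteDimensional.complete ℝ E
  have hequiv : ∀ q ∈ U, ∃ L : E ≃L[ℝ] E, (L : E →L[ℝ] E) = fderiv ℝ f q := fun q hq =>
    ⟨(LinearEquiv.ofInjectiveEndo (fderiv ℝ f q).toLinearMap (hf' q hq)).toContinuousLinearEquiv,
      by ext v; rfl⟩
  have hopen : IsOpenMap (U.domRestrict f) := by
    rw [isOpenMap_iff_nhds_le]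
    rintro ⟨q, hq⟩
    obtain ⟨L, hL⟩ := hequiv q hq
    have h1 : HasStrictFDerivAt f (L : E →L[ℝ] E) q := by
      rw [hL]
      exact (hf.contDiffAt (hU.mem_nhds hq)).hasStrictFDerivAt (by simp)
    have h2 := h1.map_nhds_eq_of_equiv
    rw [← map_nhds_subtype_coe_eq_nhds hq (hU.mem_nhds hq), Filter.map_map] at h2
    exact h2.ge
  set e : OpenPartialHomeomorph E E := OpenPartialHomeomorph.ofContinuousOpenRestrict
    (hinj.toPartialEquiv f U) hf.continuousOn hopen hU with he
  refine ⟨e, rfl, fun q => rfl, fun q hq => ContDiffAt.contDiffWithinAt ?_⟩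
  have hs : e.symm q ∈ U := e.map_target hq
  obtain ⟨L, hL⟩ := hequiv _ hs
  have h3 : ContDiffAt ℝ ∞ f (e.symm q) := hf.contDiffAt (hU.mem_nhds hs)
  exact e.contDiffAt_symm (f₀' := L) hq
    (by rw [hL]; exact (h3.differentiableAt (by simp)).hasFDerivAt) h3

/-! ### Lorentz frames and rotations -/

section Algebra

/-- The Lorentz product of the columns number `a` of `x` and number `b` of `z`. -/
def colProd (x z : Fin 3 → Fin 3 → ℝ) (a b : Fin 3) : ℝ :=
  -(x 0 a * z 0 b) + x 1 a * z 1 b + x 2 a * z 2 b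

variable {x z : Fin 3 → Fin 3 → ℝ}

/-- M η Mᵀ = η makes η Mᵀ η a right inverse of M, hence a left inverse, and so Mᵀ η M = η:
orthonormality passes from the rows to the columns, which are the vectors r, e₁, e₂. -/
theorem colProd_self
    (hx : ∀ i j, -(x i 0 * x j 0) + x i 1 * x j 1 + x i 2 * x j 2 =
      if i = j then (if i = 0 then -1 else 1) else 0) (a b : Fin 3) :
    colProd x x a b = if a = b then (if a = 0 then -1 else 1) else 0 := by
  set η : Matrix (Fin 3) (Fin 3) ℝ := Matrix.diagonal ![-1, 1, 1] with hη
  set M : Matrix (Fin 3) (Fin 3) ℝ := Matrix.of x with hM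
  have hηη : η * η = 1 := by
    rw [hη, Matrix.diagonal_mul_diagonal, ← Matrix.diagonal_one]
    congr 1
    ext i
    fin_cases i <;> simp
  have h1 : M * η * M.transpose = η := by
    ext i j
    have := hx i j
    rw [hη, hM, Matrix.mul_apply, Fin.sum_univ_three]
    simp only [Matrix.mul_diagonal, Matrix.transpose_apply, Matrix.of_apply]
    rw [show (![-1, 1, 1] : Fin 3 → ℝ) 0 = -1 from rfl,
      show (![-1, 1, 1] : Fin 3 → ℝ) 1 = 1 from rfl,
      show (![-1, 1, 1] : Fin 3 → ℝ) 2 = 1 from rfl]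
    refine Eq.trans ?_ (this.trans ?_)
    · ring
    · fin_cases i <;> fin_cases j <;> simp [Matrix.diagonal]
  have h2 : M * (η * M.transpose * η) = 1 := by
    rw [← Matrix.mul_assoc, ← Matrix.mul_assoc, h1, hηη]
  have h3 : η * M.transpose * η * M = 1 := mul_eq_one_comm.1 h2
  have h4 : M.transpose * η * M = η := by
    calc M.transpose * η * M = η * η * (M.transpose * η * M) := by rw [hηη, Matrix.one_mul]
      _ = η * (η * M.transpose * η * M) := by simp only [Matrix.mul_assoc]
      _ = η := by rw [h3, Matrix.mul_one]
  have h5 := congrFun (congrFun h4 a) b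
  rw [hη, hM, Matrix.mul_apply, Fin.sum_univ_three] at h5
  simp only [Matrix.mul_diagonal, Matrix.transpose_apply, Matrix.of_apply] at h5
  rw [show (![-1, 1, 1] : Fin 3 → ℝ) 0 = -1 from rfl,
      show (![-1, 1, 1] : Fin 3 → ℝ) 1 = 1 from rfl,
      show (![-1, 1, 1] : Fin 3 → ℝ) 2 = 1 from rfl] at h5
  rw [colProd]
  refine Eq.trans ?_ (h5.trans ?_)
  · ring
  · fin_cases a <;> fin_cases b <;> simp [Matrix.diagonal]

/-- A point of the upper sheet of the hyperboloid is determined by its two spatial coordinates, so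
these suffice as a chart. -/
theorem eq_of_sq_sub_sq {x₀ x₁ x₂ z₀ z₁ z₂ : ℝ} (hx : -(x₀ * x₀) + x₁ * x₁ + x₂ * x₂ = -1)
    (hz : -(z₀ * z₀) + z₁ * z₁ + z₂ * z₂ = -1) (h₁ : z₁ = x₁) (h₂ : z₂ = x₂) (hx₀ : 0 < x₀)
    (hz₀ : 0 < z₀) : z₀ = x₀ := by
  subst h₁ h₂
  nlinarith

/-- Two frames near the identity are near each other. Positivity excludes reflections and puts the
angle in (-π/2, π/2), where it is the arcsine of its sine. -/
theorem colProd_pos (hx : ∀ i a, |x i a - (Pi.single i 1 : Fin 3 → ℝ) a| ≤ 1 / 8)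
    (hz : ∀ i a, |z i a - (Pi.single i 1 : Fin 3 → ℝ) a| ≤ 1 / 8) :
    0 < colProd z x 1 1 ∧ 0 < colProd z x 2 2 := by
  have key : ∀ p r : ℝ, |p| ≤ 1 / 8 → |r| ≤ 1 / 8 → |p * r| ≤ 1 / 64 := fun p r hp hr => by
    rw [abs_mul]
    calc |p| * |r| ≤ 1 / 8 * (1 / 8) := by gcongr
      _ = 1 / 64 := by norm_num
  have key' : ∀ p r : ℝ, |p - 1| ≤ 1 / 8 → |r - 1| ≤ 1 / 8 → 49 / 64 ≤ p * r := fun p r hp hr => by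
    rw [abs_le] at hp hr
    nlinarith
  have a1 := abs_le.1 (key (z 0 1) (x 0 1) (by simpa using hz 0 1) (by simpa using hx 0 1))
  have a2 := key' (z 1 1) (x 1 1) (by simpa using hz 1 1) (by simpa using hx 1 1)
  have a3 := abs_le.1 (key (z 2 1) (x 2 1) (by simpa using hz 2 1) (by simpa using hx 2 1))
  have b1 := abs_le.1 (key (z 0 2) (x 0 2) (by simpa using hz 0 2) (by simpa using hx 0 2))
  have b2 := abs_le.1 (key (z 1 2) (x 1 2) (by simpa using hz 1 2) (by simpa using hx 1 2))
  have b3 := key' (z 2 2) (x 2 2) (by simpa using hz 2 2) (by simpa using hx 2 2)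
  constructor <;> rw [colProd] <;> linarith [a1.1, a1.2, a3.1, a3.2, b1.1, b1.2, b2.1, b2.2]

/-- Two nearby orthonormal frames with the same position vector differ by a rotation. -/
theorem exists_rotation
    (hx : ∀ i j, -(x i 0 * x j 0) + x i 1 * x j 1 + x i 2 * x j 2 =
      if i = j then (if i = 0 then -1 else 1) else 0)
    (hz : ∀ i j, -(z i 0 * z j 0) + z i 1 * z j 1 + z i 2 * z j 2 =
      if i = j then (if i = 0 then -1 else 1) else 0)
    (h0 : ∀ i, z i 0 = x i 0) (h1 : 0 < colProd z x 1 1) (h2 : 0 < colProd z x 2 2) :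
    colProd z x 1 1 ^ 2 + colProd z x 1 2 ^ 2 = 1 ∧
    (∀ i, z i 1 = colProd z x 1 1 * x i 1 + colProd z x 1 2 * x i 2) ∧
    ∀ i, z i 2 = -colProd z x 1 2 * x i 1 + colProd z x 1 1 * x i 2 := by
  have hzc := colProd_self hz
  have e10 : colProd z x 1 0 = 0 := by
    have := hzc 1 0
    simpa [colProd, h0] using this
  have e20 : colProd z x 2 0 = 0 := by
    have := hzc 2 0
    simpa [colProd, h0] using this
  -- Expansion in the orthonormal frame `x`. For b = 1, 2 the component along r vanishes, because r
  -- is also the first vector of `z`.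
  have expand : ∀ b i, z i b = -(colProd z x b 0 * x i 0) + colProd z x b 1 * x i 1 +
      colProd z x b 2 * x i 2 := by
    intro b i
    have r0 := hx 0 i
    have r1 := hx 1 i
    have r2 := hx 2 i
    fin_cases i <;> simp [colProd] at r0 r1 r2 ⊢ <;>
      linear_combination z 0 b * r0 - z 1 b * r1 - z 2 b * r2
  have f1 : ∀ i, z i 1 = colProd z x 1 1 * x i 1 + colProd z x 1 2 * x i 2 := fun i => by
    rw [expand 1 i, e10]; ring
  have f2 : ∀ i, z i 2 = colProd z x 2 1 * x i 1 + colProd z x 2 2 * x i 2 := fun i => by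
    rw [expand 2 i, e20]; ring
  have hxc := colProd_self hx
  have x11 : colProd x x 1 1 = 1 := by rw [hxc]; simp
  have x12 : colProd x x 1 2 = 0 := by rw [hxc]; simp
  have x22 : colProd x x 2 2 = 1 := by rw [hxc]; simp
  have z11 : colProd z z 1 1 = 1 := by rw [hzc]; simp
  have z12 : colProd z z 1 2 = 0 := by rw [hzc]; simp
  have z22 : colProd z z 2 2 = 1 := by rw [hzc]; simp
  set C := colProd z x 1 1
  set s := colProd z x 1 2
  set C' := colProd z x 2 1
  set s' := colProd z x 2 2
  simp only [colProd, f1, f2] at x11 x12 x22 z11 z12 z22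
  have g11 : C ^ 2 + s ^ 2 = 1 := by
    linear_combination z11 - C ^ 2 * x11 - 2 * C * s * x12 - s ^ 2 * x22
  have g12 : C * C' + s * s' = 0 := by
    linear_combination z12 - C * C' * x11 - (C * s' + s * C') * x12 - s * s' * x22
  have g22 : C' ^ 2 + s' ^ 2 = 1 := by
    linear_combination z22 - C' ^ 2 * x11 - 2 * C' * s' * x12 - s' ^ 2 * x22
  -- An orthogonal 2 × 2 matrix with positive diagonal is a rotation.
  have hs' : s' = C := by
    have : s' ^ 2 = C ^ 2 := by
      linear_combination C ^ 2 * g22 - s' ^ 2 * g11 - (C * C' - s * s') * g12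
    exact (pow_left_inj₀ h2.le h1.le two_ne_zero).1 this
  have hC' : C' = -s := by
    have : C * (C' + s) = 0 := by rw [hs'] at g12; linear_combination g12
    rcases mul_eq_zero.1 this with h | h
    · exact absurd h h1.ne'
    · linarith
  refine ⟨g11, f1, fun i => ?_⟩
  rw [f2, hs', hC']

end Algebra

/-! ### The determinants and Cramer's rule -/

section Determinants

variable {n : ℕ}

/-- The matrix is block triangular: the columns of the τⱼ vanish in the rows of x and t and form an
identity block below. -/
theorem Delta_eq (Y : Space n → Space n) (q : Space n) :
    Delta Y q = pd 0 (fun r => Y r 0) q * pd 1 (fun r => Y r 1) q -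
      pd 0 (fun r => Y r 1) q * pd 1 (fun r => Y r 0) q := by
  have hlt : ∀ j : Fin (n + 2), ¬ (j : ℕ) < 2 → j ≠ 0 ∧ j ≠ 1 := fun j hj => by
    constructor
    · rintro rfl; simp at hj
    · rintro rfl; simp at hj
  rw [Delta, Matrix.twoBlockTriangular_det' _ (fun k : Fin (n + 2) => (k : ℕ) < 2)]
  · have h1 : ((deltaMatrix Y q).toSquareBlockProp fun k => ¬ (k : ℕ) < 2) = 1 := by
      ext ⟨i, hi⟩ ⟨j, hj⟩
      simp [Matrix.toSquareBlockProp, deltaMatrix, (hlt j hj).1, (hlt j hj).2, Matrix.one_apply]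
    let e : Fin 2 ≃ {k : Fin (n + 2) // (k : ℕ) < 2} :=
      { toFun := fun i => ⟨Fin.castLE (by omega) i, i.2⟩
        invFun := fun k => ⟨k.1, k.2⟩
        left_inv := fun i => rfl
        right_inv := fun k => rfl }
    have e0 : (e 0).1 = 0 := rfl
    have e1 : (e 1).1 = 1 := by ext; simp [e]
    rw [h1, Matrix.det_one, mul_one, ← Matrix.det_submatrix_equiv_self e, Matrix.det_fin_two]
    simp [Matrix.toSquareBlockProp, deltaMatrix, e0, e1]
  · intro i hi j hj
    have hij : i ≠ j := by rintro rfl; exact hj hi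
    simp [deltaMatrix, (hlt j hj).1, (hlt j hj).2, hij]

/-- Since φⱼ = τⱼ near `q`, the prescribed columns of zeros and ones are the derivatives of the φⱼ,
and the matrix is the transposed Jacobian of `Y`. -/
theorem deltaMatrix_apply {Y : Space n → Space n} {q : Space n} (hY : DifferentiableAt ℝ Y q)
    (hτ : ∀ᶠ r in 𝓝 q, ∀ j : Fin n, Y r j.succ.succ = r j.succ.succ) (k l : Fin (n + 2)) :
    deltaMatrix Y q k l = fderiv ℝ Y q (Pi.single k 1) l := by
  have h1 : ∀ l, pd k (fun r => Y r l) q = fderiv ℝ Y q (Pi.single k 1) l := fun l => by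
    rw [pd, (hasFDerivAt_pi'.1 hY.hasFDerivAt l).fderiv]
    rfl
  induction l using Fin.cases with
  | zero => rw [← h1]; simp [deltaMatrix]
  | succ l =>
    induction l using Fin.cases with
    | zero => rw [← h1]; simp [deltaMatrix]
    | succ j =>
      have h2 : pd k (fun r => Y r j.succ.succ) q =
          (Pi.single k 1 : Space n) j.succ.succ := by
        have h3 : (fun r => Y r j.succ.succ) =ᶠ[𝓝 q] fun r => r j.succ.succ :=
          hτ.mono fun r hr => hr j
        rw [pd, h3.fderiv_eq, (hasFDerivAt_apply j.succ.succ q).fderiv]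
        rfl
      have h4 : j.succ.succ ≠ (1 : Fin (n + 2)) := by
        rw [← Fin.succ_zero_eq_one]
        exact fun h => Fin.succ_ne_zero j (Fin.succ_injective _ h)
      rw [← h1, h2]
      simp [deltaMatrix, h4, Pi.single_apply, eq_comm]

theorem Delta_ne_zero {Y : Space n → Space n} {q : Space n} (hY : DifferentiableAt ℝ Y q)
    (hτ : ∀ᶠ r in 𝓝 q, ∀ j : Fin n, Y r j.succ.succ = r j.succ.succ)
    (hinj : Function.Injective (fderiv ℝ Y q)) : Delta Y q ≠ 0 := by
  rw [Delta, ← Matrix.det_transpose]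
  intro h
  obtain ⟨v, hv, hv0⟩ := Matrix.exists_mulVec_eq_zero_iff.2 h
  refine hv (hinj ?_)
  rw [map_zero, ← hv0]
  ext l
  rw [Matrix.mulVec, dotProduct]
  simp only [Matrix.transpose_apply, deltaMatrix_apply hY hτ]
  have h1 : v = ∑ k, v k • (Pi.single k 1 : Space n) := by
    ext m
    simp [Pi.single_apply]
  conv_lhs => rw [h1, map_sum, Finset.sum_apply]
  exact Finset.sum_congr rfl fun k _ => by simp [mul_comm]

/-- Cramer's rule for the system with the matrix `deltaMatrix`. -/
theorem eq_DeltaCol_div {Y : Space n → Space n} {q : Space n} (h : Delta Y q ≠ 0)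
    {b c : Fin (n + 2) → ℝ} (hbc : Matrix.mulVec (deltaMatrix Y q) b = c) (l : Fin (n + 2)) :
    b l = DeltaCol Y c l q / Delta Y q := by
  rw [eq_div_iff h, DeltaCol, ← Matrix.cramer_apply, Matrix.cramer_eq_adjugate_mulVec, ← hbc,
    Matrix.mulVec_mulVec, Matrix.adjugate_mul, Matrix.smul_mulVec, Matrix.one_mulVec, mul_comm]
  rfl

end Determinants

section Algebra

variable {x : Fin 3 → Fin 3 → ℝ}

/-- The last two vectors of an orthonormal frame are linearly independent, even modulo the first. -/
theorem eq_zero_of_frame_combination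
    (hx : ∀ i j, -(x i 0 * x j 0) + x i 1 * x j 1 + x i 2 * x j 2 =
      if i = j then (if i = 0 then -1 else 1) else 0) {E A B : ℝ}
    (h : ∀ i, x i 0 * E + x i 1 * A + x i 2 * B = 0) : A = 0 ∧ B = 0 := by
  have hxx := colProd_self hx
  have x01 := hxx 0 1
  have x02 := hxx 0 2
  have x11 := hxx 1 1
  have x12 := hxx 1 2
  have x22 := hxx 2 2
  simp [colProd] at x01 x02 x11 x12 x22
  have h0 := h 0
  have h1 := h 1
  have h2 := h 2
  constructor
  · linear_combination -x 0 1 * h0 + x 1 1 * h1 + x 2 1 * h2 - E * x01 - A * x11 - B * x12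
  · linear_combination -x 0 2 * h0 + x 1 2 * h1 + x 2 2 * h2 - E * x02 - A * x12 - B * x22

end Algebra

/-! ### Position charts and the comparison of two frames -/

namespace MovingFrame

variable {H K : Hierarchy} {S : H.Solution} {T : K.Solution} (M : MovingFrame S)
  (N : MovingFrame T) {n : ℕ}

theorem contDiffOn_X (i : Fin 3) : ContDiffOn ℝ ∞ (M.X n i) (M.U n) :=
  contDiffOn_flat_system_solution (M.isOpen_U n)
    (S.contDiffOn_connection.mono (M.subset n)) (M.hasFDerivAt n i)

theorem contDiffOn_X_apply (i a : Fin 3) : ContDiffOn ℝ ∞ (fun q => M.X n i q a) (M.U n) :=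
  contDiffOn_pi.1 (M.contDiffOn_X i) a

/-- Two coordinates of the position vector of a moving frame, and the variables `τ₁, …, τₙ`. -/
def position (n : ℕ) (q : Space n) : Space n :=
  Fin.cons (M.X n 1 q 0) (Fin.cons (M.X n 2 q 0) fun j : Fin n => q j.succ.succ)

theorem position_zero (q : Space n) : M.position n q 0 = M.X n 1 q 0 := rfl

theorem position_one (q : Space n) : M.position n q 1 = M.X n 2 q 0 := rfl

theorem position_succ_succ (q : Space n) (j : Fin n) :
    M.position n q j.succ.succ = q j.succ.succ := rfl

theorem contDiffOn_position : ContDiffOn ℝ ∞ (M.position n) (M.U n) := by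
  refine contDiffOn_pi.2 fun k => ?_
  induction k using Fin.cases with
  | zero => exact M.contDiffOn_X_apply 1 0
  | succ k =>
    induction k using Fin.cases with
    | zero => exact M.contDiffOn_X_apply 2 0
    | succ j => exact (contDiff_apply ℝ ℝ j.succ.succ).contDiffOn

theorem position_incl {q : Space n} (hq : q ∈ M.U n) :
    M.position (n + 1) (incl q) = incl (M.position n q) := by
  ext k
  induction k using Fin.cases with
  | zero =>
    rw [position_zero, M.X_incl n 1 q hq, incl_zero_apply, position_zero]
  | succ k =>
    induction k using Fin.cases with
    | zero =>
      rw [Fin.succ_zero_eq_one, position_one, M.X_incl n 2 q hq, incl_one_apply, position_one]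
    | succ j =>
      rw [position_succ_succ]
      induction j using Fin.lastCases with
      | last => rw [Fin.succ_last, Fin.succ_last, incl_last, incl_last]
      | cast j =>
        rw [Fin.succ_castSucc, Fin.succ_castSucc, incl_castSucc, incl_castSucc, position_succ_succ]

/-- A vector in the kernel has no τ-components, and dr₁, dr₂ vanish on it; unless it is zero, this
contradicts `exists_pos`. -/
theorem fderiv_position_injective {q : Space n} (hq : q ∈ M.U n) :
    Function.Injective (fderiv ℝ (M.position n) q) := by
  rw [injective_iff_map_eq_zero]
  intro w hw
  have hd : HasFDerivAt (M.position n) (fderiv ℝ (M.position n) q) q :=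
    ((M.contDiffOn_position.contDiffAt ((M.isOpen_U n).mem_nhds hq)).differentiableAt
      (by simp)).hasFDerivAt
  have hτ : ∀ j : Fin n, w j.succ.succ = 0 := fun j => by
    have h := congrArg (fun L => L w) ((hasFDerivAt_pi'.1 hd j.succ.succ).unique
      (hasFDerivAt_apply j.succ.succ q))
    have h' := congrFun hw j.succ.succ
    exact h.symm.trans h'
  by_contra hw0
  obtain ⟨a, b, hab⟩ := M.exists_pos n w hτ hw0
  have hx : ∀ i, HasFDerivAt (fun q => M.X n i q 0)
      (M.X n i q 1 • S.Θ n 0 q + M.X n i q 2 • S.Θ n 1 q) q := fun i =>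
    hasFDerivAt_frame_zero (M.hasFDerivAt n i q hq)
  have h1 : M.X n 1 q 1 * S.Θ n 0 q w + M.X n 1 q 2 * S.Θ n 1 q w = 0 := by
    have h := congrArg (fun L => L w) ((hasFDerivAt_pi'.1 hd 0).unique (hx 1))
    exact h.symm.trans (congrFun hw 0)
  have h2 : M.X n 2 q 1 * S.Θ n 0 q w + M.X n 2 q 2 * S.Θ n 1 q w = 0 := by
    have h := congrArg (fun L => L w) ((hasFDerivAt_pi'.1 hd 1).unique (hx 2))
    exact h.symm.trans (congrFun hw 1)
  have := hab q hq
  rw [h1, h2] at this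
  simp at this

/-- Points with the same image have the same τ, so the segment between them stays in the domain.
Rolle's theorem for a r₁ + b r₂ on this segment would contradict `exists_pos`. -/
theorem position_injOn : InjOn (M.position n) (M.U n) := by
  intro p hp q hq hpq
  have hτ : ∀ j : Fin n, p j.succ.succ = q j.succ.succ := fun j => congrFun hpq j.succ.succ
  by_contra hne
  obtain ⟨a, b, hab⟩ := M.exists_pos n (q - p) (fun j => by simp [hτ j])
    (sub_ne_zero.2 (Ne.symm hne))
  set γ : ℝ → Space n := fun s => p + s • (q - p) with hγ
  have hmem : ∀ s ∈ Icc (0 : ℝ) 1, γ s ∈ M.U n := M.segment n p hp q hq hτ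
  have hγd : ∀ s, HasDerivAt γ (q - p) s := fun s => by
    have h := ((hasDerivAt_id s).smul_const (q - p)).const_add p
    rw [one_smul] at h
    exact h
  have hd : ∀ i, ∀ s ∈ Icc (0 : ℝ) 1, HasDerivAt (fun s => M.X n i (γ s) 0)
      (M.X n i (γ s) 1 * S.Θ n 0 (γ s) (q - p) + M.X n i (γ s) 2 * S.Θ n 1 (γ s) (q - p)) s :=
    fun i s hs => (hasFDerivAt_frame_zero (M.hasFDerivAt n i _ (hmem s hs))).comp_hasDerivAt s
      (hγd s)
  have hd' : ∀ s ∈ Icc (0 : ℝ) 1, HasDerivAt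
      (fun s => a * M.X n 1 (γ s) 0 + b * M.X n 2 (γ s) 0) _ s := fun s hs =>
    ((hd 1 s hs).const_mul a).add ((hd 2 s hs).const_mul b)
  have h01 : a * M.X n 1 (γ 0) 0 + b * M.X n 2 (γ 0) 0 =
      a * M.X n 1 (γ 1) 0 + b * M.X n 2 (γ 1) 0 := by
    have e1 : M.X n 1 p 0 = M.X n 1 q 0 := congrFun hpq 0
    have e2 : M.X n 2 p 0 = M.X n 2 q 0 := congrFun hpq 1
    simp [hγ, e1, e2]
  obtain ⟨s, hs, hs0⟩ := exists_hasDerivAt_eq_zero (zero_lt_one' ℝ)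
    (fun s hs => (hd' s hs).continuousAt.continuousWithinAt) h01
    (fun s hs => hd' s (Ioo_subset_Icc_self hs))
  exact (hab (γ s) (hmem s (Ioo_subset_Icc_self hs))).ne' hs0

theorem exists_chart (n : ℕ) : ∃ e : OpenPartialHomeomorph (Space n) (Space n),
    e.source = M.U n ∧ (∀ q, e q = M.position n q) ∧ ContDiffOn ℝ ∞ e.symm e.target :=
  exists_smooth_chart (M.isOpen_U n) M.contDiffOn_position M.position_injOn
    fun _ hq => M.fderiv_position_injective hq

theorem X_zero_pos {q : Space n} (hq : q ∈ M.U n) : 0 < M.X n 0 q 0 := by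
  have := (abs_le.1 (M.near n 0 0 q hq)).1
  simp at this
  linarith

section Matching

variable {M N} {p q : Space n}

theorem X_zero_eq_of_position_eq (hq : q ∈ M.U n) (hp : p ∈ N.U n)
    (h : N.position n p = M.position n q) (i : Fin 3) : N.X n i p 0 = M.X n i q 0 := by
  have h1 : N.X n 1 p 0 = M.X n 1 q 0 := congrFun h 0
  have h2 : N.X n 2 p 0 = M.X n 2 q 0 := congrFun h 1
  have hM := colProd_self (M.lorentz n q hq) 0 0
  have hN := colProd_self (N.lorentz n p hp) 0 0
  simp only [colProd] at hM hN
  have h0 : N.X n 0 p 0 = M.X n 0 q 0 :=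
    eq_of_sq_sub_sq (by simpa using hM) (by simpa using hN) h1 h2 (M.X_zero_pos hq)
      (N.X_zero_pos hp)
  fin_cases i
  · exact h0
  · exact h1
  · exact h2

theorem position_incl_eq (hq : q ∈ M.U n) (hp : p ∈ N.U n)
    (h : N.position n p = M.position n q) :
    N.position (n + 1) (incl p) = M.position (n + 1) (incl q) := by
  rw [M.position_incl hq, N.position_incl hp, h]

variable (M N) in
/-- The angle of the rotation that relates two moving frames. -/
noncomputable def angle (n : ℕ) (p q : Space n) : ℝ :=
  Real.arcsin (colProd (fun i => N.X n i p) (fun i => M.X n i q) 1 2)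

theorem frame_rotation (hq : q ∈ M.U n) (hp : p ∈ N.U n)
    (h : N.position n p = M.position n q) :
    0 < Real.cos (angle M N n p q) ∧
    (∀ i, N.X n i p 1 = Real.cos (angle M N n p q) * M.X n i q 1 +
      Real.sin (angle M N n p q) * M.X n i q 2) ∧
    (∀ i, N.X n i p 2 = -Real.sin (angle M N n p q) * M.X n i q 1 +
      Real.cos (angle M N n p q) * M.X n i q 2) ∧
    colProd (fun i => N.X n i p) (fun i => M.X n i q) 1 2 ≠ -1 ∧
    colProd (fun i => N.X n i p) (fun i => M.X n i q) 1 2 ≠ 1 := by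
  obtain ⟨h1, h2⟩ := colProd_pos (fun i a => M.near n i a q hq) (fun i a => N.near n i a p hp)
  obtain ⟨h3, h4, h5⟩ := exists_rotation (M.lorentz n q hq) (N.lorentz n p hp)
    (X_zero_eq_of_position_eq hq hp h) h1 h2
  set C := colProd (fun i => N.X n i p) (fun i => M.X n i q) 1 1 with hC
  set s := colProd (fun i => N.X n i p) (fun i => M.X n i q) 1 2 with hs
  -- Strict because C > 0 and C² + s² = 1; the arcsine is smooth only in the open interval.
  have hlt : -1 < s ∧ s < 1 := abs_lt.1 ((sq_lt_one_iff_abs_lt_one s).1 (by nlinarith))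
  have hsin : Real.sin (angle M N n p q) = s := Real.sin_arcsin hlt.1.le hlt.2.le
  have hcos : Real.cos (angle M N n p q) = C := by
    rw [angle, Real.cos_arcsin, ← hs, show 1 - s ^ 2 = C ^ 2 by linarith, Real.sqrt_sq h1.le]
  rw [hsin, hcos]
  exact ⟨h1, h4, h5, hlt.1.ne', hlt.2.ne⟩

theorem angle_incl (hq : q ∈ M.U n) (hp : p ∈ N.U n) :
    angle M N (n + 1) (incl p) (incl q) = angle M N n p q := by
  simp only [angle, colProd, M.X_incl n _ q hq, N.X_incl n _ p hp]

variable {Y : Space n → Space n} {W : Set (Space n)}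

theorem contDiffOn_angle (hY : ContDiffOn ℝ ∞ Y W)
    (hWM : ∀ q ∈ W, q ∈ M.U n) (hWN : ∀ q ∈ W, Y q ∈ N.U n)
    (h : ∀ q ∈ W, N.position n (Y q) = M.position n q) :
    ContDiffOn ℝ ∞ (fun q => angle M N n (Y q) q) W := by
  intro q hq
  have hx : ∀ i a, ContDiffWithinAt ℝ ∞ (fun q => M.X n i q a) W q := fun i a =>
    ((M.contDiffOn_X_apply i a).mono hWM) q hq
  have hz : ∀ i a, ContDiffWithinAt ℝ ∞ (fun q => N.X n i (Y q) a) W q := fun i a =>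
    ((N.contDiffOn_X_apply i a).comp hY hWN) q hq
  obtain ⟨-, -, -, h1, h2⟩ := frame_rotation (hWM q hq) (hWN q hq) (h q hq)
  refine (Real.contDiffAt_arcsin h1 h2).comp_contDiffWithinAt q ?_
  exact (((hz 0 1).mul (hx 0 2)).neg.add ((hz 1 1).mul (hx 1 2))).add ((hz 2 1).mul (hx 2 2))

/-- A map between the domains of two moving frames that preserves the position vectors relates
their one-forms by a rotation. -/
theorem pullback_Θ (hW : IsOpen W) (hY : ContDiffOn ℝ ∞ Y W)
    (hWM : ∀ q ∈ W, q ∈ M.U n) (hWN : ∀ q ∈ W, Y q ∈ N.U n)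
    (h : ∀ q ∈ W, N.position n (Y q) = M.position n q) (hq : q ∈ W) :
    pullback Y (T.Θ n 0) q = Real.cos (angle M N n (Y q) q) • S.Θ n 0 q +
      Real.sin (angle M N n (Y q) q) • S.Θ n 1 q ∧
    pullback Y (T.Θ n 1) q = -(Real.sin (angle M N n (Y q) q) • S.Θ n 0 q) +
      Real.cos (angle M N n (Y q) q) • S.Θ n 1 q ∧
    pullback Y (T.Θ n 2) q = S.Θ n 2 q + fderiv ℝ (fun q => angle M N n (Y q) q) q := by
  have hWq := hW.mem_nhds hq
  have hYd : HasFDerivAt Y (fderiv ℝ Y q) q :=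
    ((hY.contDiffAt hWq).differentiableAt (by simp)).hasFDerivAt
  have hμd : HasFDerivAt (fun q => angle M N n (Y q) q)
      (fderiv ℝ (fun q => angle M N n (Y q) q) q) q :=
    (((contDiffOn_angle hY hWM hWN h).contDiffAt hWq).differentiableAt (by simp)).hasFDerivAt
  obtain ⟨-, hz1, hz2, -, -⟩ := frame_rotation (hWM q hq) (hWN q hq) (h q hq)
  have hz0 := X_zero_eq_of_position_eq (hWM q hq) (hWN q hq) (h q hq)
  have hcs := Real.cos_sq_add_sin_sq (angle M N n (Y q) q)
  have hM := fun i => M.hasFDerivAt n i q (hWM q hq)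
  have hN := fun i => N.hasFDerivAt n i (Y q) (hWN q hq)
  -- The derivative of r̂ ∘ Y = r, component by component.
  have hd0 : ∀ i v, N.X n i (Y q) 1 * pullback Y (T.Θ n 0) q v +
      N.X n i (Y q) 2 * pullback Y (T.Θ n 1) q v =
      M.X n i q 1 * S.Θ n 0 q v + M.X n i q 2 * S.Θ n 1 q v := by
    intro i v
    have e1 := (hasFDerivAt_frame_zero (hN i)).comp q hYd
    have e2 := (hasFDerivAt_frame_zero (hM i)).congr_of_eventuallyEq
      (Filter.eventually_of_mem hWq fun r hr =>
        X_zero_eq_of_position_eq (hWM r hr) (hWN r hr) (h r hr) i)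
    exact congrArg (fun L => L v) (e1.unique e2)
  -- The derivative of ê₁ ∘ Y = e₁ cos μ + e₂ sin μ.
  have hd1 : ∀ i v, N.X n i (Y q) 0 * pullback Y (T.Θ n 0) q v +
      N.X n i (Y q) 2 * pullback Y (T.Θ n 2) q v =
      (Real.cos (angle M N n (Y q) q) * (M.X n i q 0 * S.Θ n 0 q v + M.X n i q 2 * S.Θ n 2 q v) +
        M.X n i q 1 * (-Real.sin (angle M N n (Y q) q) *
          fderiv ℝ (fun q => angle M N n (Y q) q) q v)) +
      (Real.sin (angle M N n (Y q) q) * (M.X n i q 0 * S.Θ n 1 q v - M.X n i q 1 * S.Θ n 2 q v) +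
        M.X n i q 2 * (Real.cos (angle M N n (Y q) q) *
          fderiv ℝ (fun q => angle M N n (Y q) q) q v)) := by
    intro i v
    have e1 := (hasFDerivAt_frame_one (hN i)).comp q hYd
    have e2 := ((hμd.cos.mul (hasFDerivAt_frame_one (hM i))).add
      (hμd.sin.mul (hasFDerivAt_frame_two (hM i)))).congr_of_eventuallyEq
      (Filter.eventually_of_mem hWq fun r hr =>
        (frame_rotation (hWM r hr) (hWN r hr) (h r hr)).2.1 i)
    exact congrArg (fun L => L v) (e1.unique e2)
  set c := Real.cos (angle M N n (Y q) q)
  set s := Real.sin (angle M N n (Y q) q)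
  simp only [hz1, hz2, hz0] at hd0 hd1
  have hx := M.lorentz n q (hWM q hq)
  have k01 : ∀ v, c * pullback Y (T.Θ n 0) q v - s * pullback Y (T.Θ n 1) q v - S.Θ n 0 q v = 0 ∧
      s * pullback Y (T.Θ n 0) q v + c * pullback Y (T.Θ n 1) q v - S.Θ n 1 q v = 0 := fun v =>
    eq_zero_of_frame_combination hx (E := 0) fun i => by linear_combination hd0 i v
  -- The e₁- and e₂-components of the last identity are -sin μ and cos μ times the same defect Υ*Θ̂₃
  -- - Θ₃ - dμ, which vanishes because cos² + sin² = 1. `E` is the component along r.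
  have k2 : ∀ v, -s * (pullback Y (T.Θ n 2) q v - S.Θ n 2 q v -
        fderiv ℝ (fun q => angle M N n (Y q) q) q v) = 0 ∧
      c * (pullback Y (T.Θ n 2) q v - S.Θ n 2 q v -
        fderiv ℝ (fun q => angle M N n (Y q) q) q v) = 0 := fun v =>
    eq_zero_of_frame_combination hx
      (E := pullback Y (T.Θ n 0) q v - c * S.Θ n 0 q v - s * S.Θ n 1 q v)
      fun i => by linear_combination hd1 i v
  refine ⟨?_, ?_, ?_⟩
  · ext v
    obtain ⟨a1, a2⟩ := k01 v
    change _ = c * S.Θ n 0 q v + s * S.Θ n 1 q v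
    linear_combination c * a1 + s * a2 - pullback Y (T.Θ n 0) q v * hcs
  · ext v
    obtain ⟨a1, a2⟩ := k01 v
    change _ = -(s * S.Θ n 0 q v) + c * S.Θ n 1 q v
    linear_combination -s * a1 + c * a2 - pullback Y (T.Θ n 1) q v * hcs
  · ext v
    obtain ⟨a1, a2⟩ := k2 v
    change _ = S.Θ n 2 q v + fderiv ℝ (fun q => angle M N n (Y q) q) q v
    linear_combination -s * a1 + c * a2 - (pullback Y (T.Θ n 2) q v - S.Θ n 2 q v -
        fderiv ℝ (fun q => angle M N n (Y q) q) q v) * hcs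

end Matching

end MovingFrame

/-! ### Assembly of the maps and the determinant formulas -/

variable {H K : Hierarchy} {S : H.Solution} {T : K.Solution} {n : ℕ}

/-- The column of the rotated one-form in terms of the pulled-back coefficients. -/
theorem deltaMatrix_mulVec {Y : Space n → Space n} {q : Space n} {μ : Space n → ℝ}
    (hY : DifferentiableAt ℝ Y q)
    (hτ : ∀ᶠ r in 𝓝 q, ∀ j : Fin n, Y r j.succ.succ = r j.succ.succ)
    (h : pullback Y (T.Θ n 0) q =
      Real.cos (μ q) • S.Θ n 0 q + Real.sin (μ q) • S.Θ n 1 q) :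
    Matrix.mulVec (deltaMatrix Y q) (fun l => T.coeff n 0 l (Y q)) = column S μ q := by
  ext k
  have h1 := congrArg (fun L => L (Pi.single k 1)) h
  simp only [pullback, ContinuousLinearMap.comp_apply, _root_.add_apply, _root_.smul_apply,
    Hierarchy.Solution.Θ_apply, smul_eq_mul] at h1
  rw [Matrix.mulVec, dotProduct, column]
  simp only [deltaMatrix_apply hY hτ]
  refine (Finset.sum_congr rfl fun l _ => mul_comm _ _).trans (h1.trans ?_)
  simp [Pi.single_apply, mul_comm]

theorem fderiv_injective_of_leftInverse {E : Type*} [NormedAddCommGroup E] [NormedSpace ℝ E]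
    {f g : E → E} {q : E} (hf : DifferentiableAt ℝ f q) (hg : DifferentiableAt ℝ g (f q))
    (h : ∀ᶠ r in 𝓝 q, g (f r) = r) : Function.Injective (fderiv ℝ f q) := by
  have h1 : HasFDerivAt (fun r => g (f r)) ((fderiv ℝ g (f q)).comp (fderiv ℝ f q)) q :=
    hg.hasFDerivAt.comp q hf.hasFDerivAt
  have h2 : HasFDerivAt (fun r => g (f r)) (ContinuousLinearMap.id ℝ E) q :=
    (hasFDerivAt_id q).congr_of_eventuallyEq h
  intro v w hvw
  have h3 : ∀ v, fderiv ℝ g (f q) (fderiv ℝ f q v) = v := fun v =>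
    congrArg (fun L => L v) (h1.unique h2)
  rw [← h3 v, hvw, h3 w]

end PSS

theorem mainTheorem6 (H K : PSS.Hierarchy) (S : H.Solution) (T : K.Solution)
    (hS : S.IIIGeneric) (hT : T.IIIGeneric) :
    ∃ (Y : ∀ n : ℕ, OpenPartialHomeomorph (PSS.Space n) (PSS.Space n))
      (μ : ∀ n : ℕ, PSS.Space n → ℝ),
      -- each `Y n` is a diffeomorphism of open sets (its source and its target), and `μ n` is smooth
      (∀ n, (Y n).source.Nonempty ∧ (Y n).source ⊆ S.V n ∧ (Y n).target ⊆ T.V n ∧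
        ContDiffOn ℝ ∞ (Y n) (Y n).source ∧ ContDiffOn ℝ ∞ (Y n).symm (Y n).target ∧
        ContDiffOn ℝ ∞ (μ n) (Y n).source) ∧
      -- the pulled-back coefficients as quotients of determinants
      (∀ n, ∀ q ∈ (Y n).source,
        PSS.Delta (Y n) q =
          PSS.pd 0 (fun r => Y n r 0) q * PSS.pd 1 (fun r => Y n r 1) q -
            PSS.pd 0 (fun r => Y n r 1) q * PSS.pd 1 (fun r => Y n r 0) q ∧
        PSS.Delta (Y n) q ≠ 0 ∧
        T.f n 0 0 (Y n q) =
          PSS.DeltaCol (Y n) (PSS.column S (μ n) q) 0 q / PSS.Delta (Y n) q ∧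
        T.f n 0 1 (Y n q) =
          PSS.DeltaCol (Y n) (PSS.column S (μ n) q) 1 q / PSS.Delta (Y n) q ∧
        (∀ j : Fin n, T.h n 0 j (Y n q) =
          PSS.DeltaCol (Y n) (PSS.column S (μ n) q) j.succ.succ q / PSS.Delta (Y n) q)) ∧
      -- `φⱼ = τⱼ`
      (∀ n, ∀ q ∈ (Y n).source, ∀ j : Fin n, Y n q j.succ.succ = q j.succ.succ) ∧
      -- the one-forms of the two hierarchies correspond up to a rotation by `μ n`
      (∀ n, ∀ q ∈ (Y n).source,
        PSS.pullback (Y n) (T.Θ n 0) q =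
          Real.cos (μ n q) • S.Θ n 0 q + Real.sin (μ n q) • S.Θ n 1 q ∧
        PSS.pullback (Y n) (T.Θ n 1) q =
          -(Real.sin (μ n q) • S.Θ n 0 q) + Real.cos (μ n q) • S.Θ n 1 q ∧
        PSS.pullback (Y n) (T.Θ n 2) q = S.Θ n 2 q + fderiv ℝ (μ n) q) ∧
      -- compatibility of the members of the two sequences
      (∀ n, ∀ q ∈ (Y n).source, PSS.incl q ∈ (Y (n + 1)).source ∧
        Y (n + 1) (PSS.incl q) = PSS.incl (Y n q) ∧ μ (n + 1) (PSS.incl q) = μ n q) := by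
  obtain ⟨M⟩ := PSS.exists_movingFrame hS
  obtain ⟨N⟩ := PSS.exists_movingFrame hT
  choose e he he_apply he_symm using M.exists_chart
  choose d hd hd_apply hd_symm using N.exists_chart
  -- Υ is the position chart of the first frame followed by the inverse of that of the second.
  set Y : ∀ n : ℕ, OpenPartialHomeomorph (PSS.Space n) (PSS.Space n) :=
    fun n => (e n).trans (d n).symm with hYdef
  have hsrc : ∀ n q, q ∈ (Y n).source ↔ q ∈ M.U n ∧ M.position n q ∈ (d n).target := fun n q => by
    rw [hYdef, OpenPartialHomeomorph.trans_source, he, Set.mem_inter_iff, Set.mem_preimage,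
      he_apply]
    rfl
  have hYapp : ∀ n q, Y n q = (d n).symm (M.position n q) := fun n q => by
    rw [hYdef, OpenPartialHomeomorph.coe_trans, Function.comp_apply, he_apply]
  have hM : ∀ n, ∀ q ∈ (Y n).source, q ∈ M.U n := fun n q hq => ((hsrc n q).1 hq).1
  have hN : ∀ n, ∀ q ∈ (Y n).source, Y n q ∈ N.U n := fun n q hq => by
    rw [hYapp, ← hd n]
    exact (d n).map_target ((hsrc n q).1 hq).2
  have hpos : ∀ n, ∀ q ∈ (Y n).source, N.position n (Y n q) = M.position n q := fun n q hq => by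
    rw [← hd_apply, hYapp]
    exact (d n).right_inv ((hsrc n q).1 hq).2
  -- By injectivity of the charts, equality of positions characterises the graph of Υ. Compatibility
  -- of successive members reduces to this.
  have hmem : ∀ n, ∀ q ∈ M.U n, ∀ p ∈ N.U n, N.position n p = M.position n q →
      q ∈ (Y n).source ∧ Y n q = p := fun n q hq p hp h => by
    have hp' : p ∈ (d n).source := by rwa [hd]
    refine ⟨(hsrc n q).2 ⟨hq, ?_⟩, ?_⟩
    · rw [← h, ← hd_apply]
      exact (d n).map_source hp'
    · rw [hYapp, ← h, ← hd_apply]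
      exact (d n).left_inv hp'
  have hτ : ∀ n, ∀ q ∈ (Y n).source, ∀ j : Fin n, Y n q j.succ.succ = q j.succ.succ :=
    fun n q hq j => congrFun (hpos n q hq) j.succ.succ
  have hcompat : ∀ n, ∀ q ∈ (Y n).source, PSS.incl q ∈ (Y (n + 1)).source ∧
      Y (n + 1) (PSS.incl q) = PSS.incl (Y n q) := fun n q hq =>
    hmem (n + 1) _ (M.incl_mem n q (hM n q hq)) _ (N.incl_mem n _ (hN n q hq))
      (PSS.MovingFrame.position_incl_eq (hM n q hq) (hN n q hq) (hpos n q hq))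
  -- Both frames are the identity at their base points, so these two points correspond for n = 0;
  -- the inclusions carry the pair to all n.
  have hne : ∀ n, (Y n).source.Nonempty := by
    intro n
    induction n with
    | zero =>
      refine ⟨M.c, (hmem 0 M.c M.c_mem N.c N.c_mem ?_).1⟩
      refine PSS.space_ext ?_ ?_ fun j => j.elim0
      · rw [PSS.MovingFrame.position_zero, PSS.MovingFrame.position_zero, M.X_c, N.X_c]
      · rw [PSS.MovingFrame.position_one, PSS.MovingFrame.position_one, M.X_c, N.X_c]
    | succ n ih =>
      obtain ⟨q, hq⟩ := ih
      exact ⟨_, (hcompat n q hq).1⟩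
  have hYs : ∀ n, ContDiffOn ℝ ∞ (Y n) (Y n).source := fun n =>
    ((hd_symm n).comp (M.contDiffOn_position.mono (hM n)) fun q hq => ((hsrc n q).1 hq).2).congr
      fun q _ => hYapp n q
  have hYs' : ∀ n, ContDiffOn ℝ ∞ (Y n).symm (Y n).target := fun n => by
    have h1 : ∀ p ∈ (Y n).target, p ∈ N.U n ∧ N.position n p ∈ (e n).target := fun p hp => by
      rw [hYdef, OpenPartialHomeomorph.trans_target, OpenPartialHomeomorph.symm_target, hd,
        OpenPartialHomeomorph.symm_symm, Set.mem_inter_iff, Set.mem_preimage, hd_apply] at hp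
      exact hp
    refine ((he_symm n).comp (N.contDiffOn_position.mono fun p hp => (h1 p hp).1)
      fun p hp => (h1 p hp).2).congr fun p _ => ?_
    rw [Function.comp_apply, ← hd_apply]
    rfl
  set μ : ∀ n : ℕ, PSS.Space n → ℝ := fun n q => PSS.MovingFrame.angle M N n (Y n q) q with hμ
  have hforms := fun n q (hq : q ∈ (Y n).source) =>
    PSS.MovingFrame.pullback_Θ (Y n).open_source (hYs n) (hM n) (hN n) (hpos n) hq
  have hdiff : ∀ n, ∀ q ∈ (Y n).source, DifferentiableAt ℝ (Y n) q := fun n q hq =>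
    ((hYs n).contDiffAt ((Y n).open_source.mem_nhds hq)).differentiableAt (by simp)
  have hτ' : ∀ n, ∀ q ∈ (Y n).source,
      ∀ᶠ r in nhds q, ∀ j : Fin n, Y n r j.succ.succ = r j.succ.succ := fun n q hq =>
    Filter.eventually_of_mem ((Y n).open_source.mem_nhds hq) (hτ n)
  refine ⟨Y, μ, fun n => ⟨hne n, fun q hq => M.subset n (hM n q hq), fun p hp => ?_, hYs n, hYs' n,
    PSS.MovingFrame.contDiffOn_angle (hYs n) (hM n) (hN n) (hpos n)⟩, fun n q hq => ?_, hτ, hforms,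
    fun n q hq => ⟨(hcompat n q hq).1, (hcompat n q hq).2, ?_⟩⟩
  · rw [← (Y n).right_inv hp]
    exact N.subset n (hN n _ ((Y n).map_target hp))
  · have hΔ : PSS.Delta (Y n) q ≠ 0 :=
      PSS.Delta_ne_zero (hdiff n q hq) (hτ' n q hq) (PSS.fderiv_injective_of_leftInverse
        (g := (Y n).symm) (hdiff n q hq)
        (((hYs' n).contDiffAt ((Y n).open_target.mem_nhds ((Y n).map_source hq))).differentiableAt
          (by simp))
        (Filter.eventually_of_mem ((Y n).open_source.mem_nhds hq) fun r hr => (Y n).left_inv hr))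
    have hcol := PSS.eq_DeltaCol_div hΔ (PSS.deltaMatrix_mulVec (S := S) (T := T) (μ := μ n)
      (hdiff n q hq) (hτ' n q hq) (hforms n q hq).1)
    exact ⟨PSS.Delta_eq _ _, hΔ, hcol 0, hcol 1, fun j => hcol j.succ.succ⟩
  · simp only [hμ]
    rw [(hcompat n q hq).2, PSS.MovingFrame.angle_incl (hM n q hq) (hN n q hq)]
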